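/- **Setting.** The input $(a_1,\dots,a_n)$ is a uniformly random permutation of $\{1,\dots,n\}$. For $n\ge 2$ the pivots are $p=\min(a_1,a_n)$ and $q=\max(a_1,a_n)$; an element $a_i$, $2\le i\le n-1$, is *small* if $a_i<p$, *medium* if $p<a_i<q$ and *large* if $a_i>q$. There are $s=p-1$ small and $\ell=n-q$ large elements. A *decision tree* for $n$ elements is a ternary tree whose inner nodes $v$ are labelled with an index in $\{2,\dots,n-1\}$ and with a pivot, the smaller or the larger one, such that each index occurs exactly once on each root-to-leaf path. At $v$ the element with the given index is compared first with the given pivot and then, if its class is not yet determined, with the other one; the three edges out of $v$ correspond to the outcomes small, medium, large. Let $S_2$ be the number of small elements compared with the larger pivot first, and $L_2$ the number of large elements compared with the smaller pivot first. A strategy provides a decision tree, which may depend on $s$ and $\ell$, and its *additional cost term* is $$\mathrm{ACT}=\frac1{\binom n2}\sum_{s+\ell\le n-2}\mathrm E(S_2+L_2\mid s,\ell).$$ For a node $v$ let $s_v$ and $\ell_v$ be the numbers of elements classified as small and as large before $v$ is reached. In *strategy $\mathcal L$* the label of $v$ is the smaller pivot if $s_v>\ell_v$, and the larger pivot otherwise.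 In *strategy $\mathcal O$*, given $s$ and $\ell$, the label of $v$ is the smaller pivot if $s-s_v>\ell-\ell_v$, and the larger pivot otherwise. In both strategies the order in which the elements are inspected (the index labels) is arbitrary. *Dual pivot quicksort using $\mathcal L$* does nothing if $n\le 1$. If $n\ge2$, it compares $a_1$ with $a_n$ to find $p$ and $q$, classifies the other elements with a decision tree for $n$ elements (the same one for all subarrays of length $n$) labelled according to $\mathcal L$, arranges the small, the medium and the large elements in three subarrays, in orders of positions that depend only on the path taken in the tree, and sorts the three subarrays recursively. Let $C_n^{\mathcal L}$ be the number of key comparisons that it makes. **Theorem.** 1. Strategy $\mathcal L$ is implementable: for every $n$ there is a single decision tree, not depending on $s$ and $\ell$, that is labelled according to $\mathcal L$. 2. $\mathrm{ACT}_{\mathcal L}=\mathrm{ACT}_{\mathcal O}+O(\log n)$, that is, there is a constant $C$ such that $|\mathrm{ACT}_{\mathcal L}-\mathrm{ACT}_{\mathcal O}|\le C\log n$ for all $n\ge2$, whatever the orders of inspection. 3. When $\mathcal L$ is used in dual pivot quicksort, $\mathrm E(C^{\mathcal L}_n)=1.8\,n\ln n+O(n)$, that is, there is a constant $C$, independent of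 the orders of inspection and of the arrangements of the subarrays, such that $|\mathrm E(C^{\mathcal L}_n)-1.8\,n\ln n|\le C\,n$ for all $n\ge 1$. -/

import Mathlib

open scoped BigOperators

namespace DualPivot

/-- The three outcomes of a classification; they label the edges of a decision tree. -/
inductive Cls
  | small | medium | large
  deriving DecidableEq

/-- The label of a decision tree node: the pivot the element is compared with first, the smaller
one `p` or the larger one `q`. -/
inductive Pivot
  | p | q
  deriving DecidableEq

/-- Three-way decision trees. A node carries the (1-based) index `i` of the inspected element and
the pivot `l` with which that element is compared first. -/
inductive DTree
  | leaf : DTree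
  | node (i : ℕ) (l : Pivot) (child : Cls → DTree) : DTree

/-- Classification of `x` with pivots `p < q` by key comparisons, starting with the pivot `l`.
Returns the class together with the number of key comparisons that were made. -/
def classify (l : Pivot) (p q x : ℕ) : Cls × ℕ :=
  match l with
  | .p => if x < p then (.small, 1) else if x < q then (.medium, 2) else (.large, 2)
  | .q => if q < x then (.large, 1) else if p < x then (.medium, 2) else (.small, 2)

/-- One inspected element on a root-to-leaf path: its index, the node label, the edge label. -/
structure Step where
  idx : ℕ
  label : Pivot
  cls : Cls

namespace DTree

/-- On every root-to-leaf path each index of `S` occurs exactly once, and no other index does. -/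
def Covers : DTree → Finset ℕ → Prop
  | leaf, S => S = ∅
  | node i _ child, S => i ∈ S ∧ ∀ c, (child c).Covers (S.erase i)

/-- Every node `v` carries the label `rule s_v ℓ_v`, where `s_v` and `ℓ_v` are the numbers of
elements that were classified as small and as large before `v` is reached
(the numbers `sv`, `lv` at the root being given). -/
def Follows (rule : ℕ → ℕ → Pivot) : DTree → ℕ → ℕ → Prop
  | leaf, _, _ => True
  | node _ l child, sv, lv =>
      l = rule sv lv ∧
        ∀ c, (child c).Follows rule (sv + if c = .small then 1 else 0)
          (lv + if c = .large then 1 else 0)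

/-- The path determined by the input `a` (`a i` is the `i`-th element) and pivots `p < q`. -/
def path (p q : ℕ) (a : ℕ → ℕ) : DTree → List Step
  | leaf => []
  | node i l child =>
      ⟨i, l, (classify l p q (a i)).1⟩ :: (child (classify l p q (a i)).1).path p q a

/-- The number of key comparisons made along the path determined by the input. -/
def comparisons (p q : ℕ) (a : ℕ → ℕ) : DTree → ℕ
  | leaf => 0
  | node i l child =>
      (classify l p q (a i)).2 + (child (classify l p q (a i)).1).comparisons p q a

theorem length_path {p q : ℕ} {a : ℕ → ℕ} (t : DTree) :
    ∀ {S : Finset ℕ}, t.Covers S → (t.path p q a).length = S.card := by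
  induction t with
  | leaf => intro S h; simp only [Covers] at h; simp [path, h]
  | node i l child ih =>
    intro S h
    simp only [path, List.length_cons, ih _ (h.2 _)]
    exact Finset.card_erase_add_one h.1

end DTree

/-- Classification trees for inputs `a_1, …, a_n` with pivots `a_1` and `a_n`:
each of the indices `2, …, n - 1` is inspected exactly once on each path. -/
structure ClassTree (n : ℕ) where
  tree : DTree
  covers : tree.Covers (Finset.Icc 2 (n - 1))

/-- Strategy `L`: smaller pivot first iff more small than large elements were seen so far. -/
def ruleL (sv lv : ℕ) : Pivot := if sv > lv then .p else .q

/-- Strategy `O` for inputs with `s` small and `l` large elements: smaller pivot first iff among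
the elements not yet classified there are more small than large ones. -/
def ruleO (s l sv lv : ℕ) : Pivot := if (s : ℤ) - sv > (l : ℤ) - lv then .p else .q

/-- The tree `t` implements the labelling rule `rule`. -/
def ClassTree.Implements {n : ℕ} (t : ClassTree n) (rule : ℕ → ℕ → Pivot) : Prop :=
  t.tree.Follows rule 0 0

/-- The number of additional comparisons on a path: small elements compared with the larger pivot
first, plus large elements compared with the smaller pivot first. -/
def additionalCost (π : List Step) : ℕ :=
  π.countP fun v => (v.cls = .small ∧ v.label = .q) ∨ (v.cls = .large ∧ v.label = .p)

/-- The `i`-th element of a list, with indices starting at `1`. -/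
def elt (xs : List ℕ) (i : ℕ) : ℕ := xs.getD (i - 1) 0

/-- The smaller one of the first and the last element. -/
def pivotP (xs : List ℕ) : ℕ := min (elt xs 1) (elt xs xs.length)

/-- The larger one of the first and the last element. -/
def pivotQ (xs : List ℕ) : ℕ := max (elt xs 1) (elt xs xs.length)

/-- The input sequence `(a_1, …, a_n)` given by a permutation of `{1, …, n}`. -/
def input {n : ℕ} (σ : Equiv.Perm (Fin n)) : List ℕ := List.ofFn fun i => (σ i : ℕ) + 1

/-- `E(S₂ + L₂ ∣ s, ℓ)`: the average number of additional comparisons made by the tree `t`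
on a random permutation of `{1, …, n}`, given that there are exactly `s` small and exactly `l`
large elements, that is, given that the pivots are `p = s + 1` and `q = n - l`. -/
noncomputable def condCost {n : ℕ} (t : ClassTree n) (s l : ℕ) : ℝ :=
  𝔼 σ : Equiv.Perm (Fin n) with pivotP (input σ) = s + 1 ∧ pivotQ (input σ) + l = n,
    (additionalCost (t.tree.path (pivotP (input σ)) (pivotQ (input σ)) (elt (input σ))) : ℝ)

/-- The additional cost term of a strategy for `n` elements; the strategy may use a
different tree `T s l` for each pair of numbers `s` of small and `l` of large elements. -/
noncomputable def ACT (n : ℕ) (T : ℕ → ℕ → ClassTree n) : ℝ :=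
  1 / (n.choose 2 : ℝ) *
    ∑ s ∈ Finset.range (n - 1), ∑ l ∈ Finset.range (n - 1 - s), condCost (T s l) s l

/-- A way of moving the elements around after (or during) classification: depending on the
classification path only, it fixes for each of the three groups the order in which the elements of
the group (given by their indices) are arranged in the corresponding subarray. -/
structure Arrangement where
  arrange : List Step → Cls → List ℕ
  perm : ∀ π c, (arrange π c).Perm ((π.filter fun v => v.cls = c).map Step.idx)

theorem Arrangement.length_lt (R : Arrangement) {n : ℕ} (t : ClassTree n) (hn : ¬ n ≤ 1)
    (p q : ℕ) (a : ℕ → ℕ) (c : Cls) : (R.arrange (t.tree.path p q a) c).length < n := by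
  rw [(R.perm _ c).length_eq, List.length_map]
  refine (List.length_filter_le _ _).trans_lt ?_
  rw [DTree.length_path _ t.covers, Nat.card_Icc]
  omega

/-- Dual pivot quicksort: returns the output and the number of key comparisons. Subarrays of length
`n` are classified with the tree `T n`, with the first and last element as pivots; one comparison
finds out which pivot is the smaller one. The three groups, arranged according to `R`, are sorted
recursively. -/
def quicksort (T : ∀ n, ClassTree n) (R : Arrangement) (xs : List ℕ) : List ℕ × ℕ :=
  if h : xs.length ≤ 1 then (xs, 0)
  else
    let p := pivotP xs
    let q := pivotQ xs
    let t := (T xs.length).tree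
    let π := t.path p q (elt xs)
    let S := quicksort T R ((R.arrange π .small).map (elt xs))
    let M := quicksort T R ((R.arrange π .medium).map (elt xs))
    let L := quicksort T R ((R.arrange π .large).map (elt xs))
    (S.1 ++ p :: (M.1 ++ q :: L.1), 1 + t.comparisons p q (elt xs) + S.2 + M.2 + L.2)
termination_by xs.length
decreasing_by
  all_goals
    rw [List.length_map]
    exact R.length_lt (T xs.length) h _ _ _ _

/-- `E(C_n)`: the average number of key comparisons that dual pivot quicksort makes on a random
permutation of `{1, …, n}`. -/
noncomputable def avgComparisons (T : ∀ n, ClassTree n) (R : Arrangement) (n : ℕ) : ℝ :=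
  𝔼 σ : Equiv.Perm (Fin n), ((quicksort T R (input σ)).2 : ℝ)

end DualPivot

/-!
Only the sequence of classes along the path in a decision tree matters for the additional cost.
Whatever the order of inspection, a tree sets up a bijection between class assignments and
sequences of classes (`DTree.exists_word_eq_iff`), so a sequence `w` with `s` small, `m` medium and
`l` large elements comes from exactly `2 * s! * m! * l!` of the `n!` inputs (`card_word_eq`). This
is the law of Pólya's urn with three colours: after `t` steps all pairs of numbers of small and
large elements are equally likely (`mean_counts`), and the next element is small with probability
`(x + 1) / (t + 3)`, where `x` is the number of small elements seen so far (`weight_cons`).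

Strategy `O` labels a node according to the elements still to come. Read backwards it becomes a rule
that looks at the past (`ruleCost_ruleO`), and the law is invariant under reversal. The step costs
of `L` and of reversed `O` then differ only where the number `x` of small and the number `y` of large
elements satisfy `x = y` or `x = y + 1`. At time `t` this has probability `O(1 / t)`, and summing
over `t` gives `O(log n)` (`abs_mean_costL_sub_mean_costO_le`).

A step of `L` costs an additional comparison with probability `(min x y + 1) / (t + 3)` given `x`
and `y`; on average this is `1 / 6 + O(1 / t)`, so the additional cost term of `L` is `n / 6 + O(log n)`
(`abs_mean_costL_sub_le`). As a third of the elements is medium on average, classification takes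
`n + n / 3 + n / 6 = 3 / 2 * n` comparisons up to `O(log n)`.

Given the pivots, permuting the values within a class does not change the path, so the subarrays
are in random order (`sum_quicksort_subarray_of_pivots`), and as quicksort is comparison based
(`quicksort_map_snd`) this yields the recurrence `avgComparisons_recurrence`. Its solution for the
toll `3 / 2 * (n + 1)` is `9 / 5 * (n + 1) * H_{n + 1}` (`mul_harmonic_recurrence`); a logarithmic
error in the toll changes the solution by `O(n)` only (`abs_le_of_recurrence`).
-/

namespace DualPivot

/-! ### Decision trees -/

instance : Fintype Cls := ⟨{.small, .medium, .large}, fun c => by cases c <;> decide⟩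

theorem sum_cls {M : Type*} [AddCommMonoid M] (f : Cls → M) :
    ∑ c, f c = f .small + f .medium + f .large := by
  have : (Finset.univ : Finset Cls) = {.small, .medium, .large} := rfl
  rw [this, Finset.sum_insert (by decide), Finset.sum_insert (by decide), Finset.sum_singleton,
    add_assoc]

theorem count_cls (w : List Cls) :
    w.count .small + w.count .medium + w.count .large = w.length := by
  induction w with
  | nil => rfl
  | cons c w ih => cases c <;> simp <;> omega

/-- The class of the value `x` with respect to the pivots `p < q`, without reference to the order
of the comparisons. The values `p` and `q` themselves get the junk classes `medium`, `large`. -/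
def clsOf (p q x : ℕ) : Cls := if x < p then .small else if x < q then .medium else .large

theorem classify_fst {p q x : ℕ} (l : Pivot) (hpq : p < q) (hp : x ≠ p) (hq : x ≠ q) :
    (classify l p q x).1 = clsOf p q x := by
  cases l <;> simp only [classify, clsOf] <;> split_ifs <;> first | rfl | omega

namespace DTree

/-- The path in the tree when the element with index `i` has class `d i`. -/
def trace (d : ℕ → Cls) : DTree → List Step
  | leaf => []
  | node i l child => ⟨i, l, d i⟩ :: (child (d i)).trace d

/-- The sequence of edge labels on the path when the element with index `i` has class `d i`. -/
def word (d : ℕ → Cls) : DTree → List Cls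
  | leaf => []
  | node i _ child => d i :: (child (d i)).word d

theorem map_cls_trace (d : ℕ → Cls) (t : DTree) : (t.trace d).map Step.cls = t.word d := by
  induction t with
  | leaf => rfl
  | node i l child ih => simp [trace, word, ih]

theorem path_eq_trace {p q : ℕ} {a : ℕ → ℕ} {d : ℕ → Cls} (t : DTree) :
    ∀ {S : Finset ℕ}, t.Covers S → (∀ i ∈ S, ∀ l, (classify l p q (a i)).1 = d i) →
      t.path p q a = t.trace d := by
  induction t with
  | leaf => intro S _ _; rfl
  | node i l child ih =>
    intro S h hd
    simp only [path, trace, hd i h.1 l]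
    rw [ih _ (h.2 _) fun j hj => hd j (Finset.mem_of_mem_erase hj)]

theorem cls_of_mem_trace {d : ℕ → Cls} {v : Step} (t : DTree) (hv : v ∈ t.trace d) :
    v.cls = d v.idx := by
  induction t with
  | leaf => simp [trace] at hv
  | node i l child ih =>
    rcases List.mem_cons.1 hv with rfl | hv
    · rfl
    · exact ih _ hv

theorem map_idx_trace {d : ℕ → Cls} (t : DTree) :
    ∀ {S : Finset ℕ}, t.Covers S → (((t.trace d).map Step.idx : List ℕ) : Multiset ℕ) = S.val := by
  induction t with
  | leaf => intro S h; simp only [Covers] at h; simp [trace, h]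
  | node i l child ih =>
    intro S h
    rw [trace, List.map_cons, ← Multiset.cons_coe, ih _ (h.2 _), Finset.erase_val]
    exact Multiset.cons_erase h.1

theorem word_eq_map {d : ℕ → Cls} (t : DTree) : t.word d = ((t.trace d).map Step.idx).map d := by
  rw [← map_cls_trace, List.map_map]
  exact List.map_congr_left fun v hv => cls_of_mem_trace t hv

theorem count_word {d : ℕ → Cls} {t : DTree} {S : Finset ℕ} (h : t.Covers S) (c : Cls) :
    (t.word d).count c = (S.filter fun i => d i = c).card := by
  rw [word_eq_map, ← Multiset.coe_count, ← Multiset.map_coe, map_idx_trace t h,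
    Multiset.count_map]
  simp only [Finset.card_def, Finset.filter_val, eq_comm]

theorem length_word {d : ℕ → Cls} {t : DTree} {S : Finset ℕ} (h : t.Covers S) :
    (t.word d).length = S.card := by
  rw [word_eq_map, List.length_map, ← Multiset.coe_card, map_idx_trace t h, Finset.card_def]

/-- Whatever the order of inspection, a decision tree sets up a bijection between the class
assignments and the sequences of edge labels. -/
theorem exists_word_eq_iff (t : DTree) :
    ∀ {S : Finset ℕ} {w : List Cls}, t.Covers S → w.length = S.card →
      ∃ d : ℕ → Cls, ∀ d', t.word d' = w ↔ ∀ i ∈ S, d' i = d i := by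
  induction t with
  | leaf =>
    intro S w h hw
    simp only [Covers] at h
    subst h
    have : w = [] := by simpa using hw
    exact ⟨fun _ => .small, fun d' => by simp [this, word]⟩
  | node i l child ih =>
    intro S w h hw
    have hS := Finset.card_erase_add_one h.1
    cases w with
    | nil => simp only [List.length_nil] at hw; omega
    | cons c w =>
      obtain ⟨d, hd⟩ := ih c (w := w) (h.2 c) (by simp only [List.length_cons] at hw; omega)
      refine ⟨Function.update d i c, fun d' => ?_⟩
      rw [word, List.cons_eq_cons]
      constructor
      · rintro ⟨h1, h2⟩ j hj
        rw [h1, hd] at h2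
        by_cases hji : j = i
        · subst hji; simpa using h1
        · rw [Function.update_of_ne hji]; exact h2 j (Finset.mem_erase.2 ⟨hji, hj⟩)
      · intro hj
        have h1 : d' i = c := by simpa using hj i h.1
        refine ⟨h1, ?_⟩
        rw [h1, hd]
        intro j hj'
        have := hj j (Finset.mem_of_mem_erase hj')
        rwa [Function.update_of_ne (Finset.ne_of_mem_erase hj')] at this

/-- The tree that inspects the elements in the order of the list, labelled according to `rule`. -/
def ofList (rule : ℕ → ℕ → Pivot) : List ℕ → ℕ → ℕ → DTree
  | [], _, _ => leaf
  | i :: is, sv, lv => node i (rule sv lv) fun c =>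
      ofList rule is (sv + if c = .small then 1 else 0) (lv + if c = .large then 1 else 0)

theorem covers_ofList (rule : ℕ → ℕ → Pivot) {is : List ℕ} (h : is.Nodup) (sv lv : ℕ) :
    (ofList rule is sv lv).Covers is.toFinset := by
  induction is generalizing sv lv with
  | nil => simp [ofList, Covers]
  | cons i is ih =>
    rw [List.nodup_cons] at h
    refine ⟨by simp, fun c => ?_⟩
    rw [List.toFinset_cons, Finset.erase_insert (by simpa using h.1)]
    exact ih h.2 _ _

theorem follows_ofList (rule : ℕ → ℕ → Pivot) (is : List ℕ) (sv lv : ℕ) :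
    (ofList rule is sv lv).Follows rule sv lv := by
  induction is generalizing sv lv with
  | nil => trivial
  | cons i is ih => exact ⟨rfl, fun c => ih _ _⟩

end DTree

theorem exists_implements (n : ℕ) (rule : ℕ → ℕ → Pivot) :
    ∃ t : ClassTree n, t.Implements rule := by
  refine ⟨⟨DTree.ofList rule (Finset.Icc 2 (n - 1)).toList 0 0, ?_⟩, DTree.follows_ofList _ _ _ _⟩
  simpa using DTree.covers_ofList rule (Finset.Icc 2 (n - 1)).nodup_toList 0 0

/-! ### The cost of a sequence of classes -/

/-- The number of additional comparisons caused by a sequence of classes, first class at the head,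
if the nodes are labelled according to `rule`. -/
def ruleCost (rule : ℕ → ℕ → Pivot) : ℕ → ℕ → List Cls → ℕ
  | _, _, [] => 0
  | sv, lv, c :: w =>
      (if (c = .small ∧ rule sv lv = .q) ∨ (c = .large ∧ rule sv lv = .p) then 1 else 0) +
        ruleCost rule (sv + if c = .small then 1 else 0) (lv + if c = .large then 1 else 0) w

theorem additionalCost_trace {rule : ℕ → ℕ → Pivot} {d : ℕ → Cls} (t : DTree) :
    ∀ {sv lv : ℕ}, t.Follows rule sv lv →
      additionalCost (t.trace d) = ruleCost rule sv lv (t.word d) := by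
  induction t with
  | leaf => intros; rfl
  | node i l child ih =>
    intro sv lv h
    have h2 := ih (d i) (h.2 (d i))
    simp only [additionalCost] at h2
    simp only [DTree.trace, DTree.word, ruleCost, additionalCost, List.countP_cons, h2, ← h.1,
      decide_eq_true_eq]
    rw [add_comm]

/-- Every element takes one comparison, the medium ones take a second one, and so do the small and
large elements counted by `additionalCost`. -/
theorem comparisons_eq (p q : ℕ) (a : ℕ → ℕ) (t : DTree) :
    t.comparisons p q a = (t.path p q a).length +
      ((t.path p q a).map Step.cls).count .medium + additionalCost (t.path p q a) := by
  induction t with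
  | leaf => rfl
  | node i l child ih =>
    have key : (classify l p q (a i)).2 = 1 +
        (if (classify l p q (a i)).1 = .medium then 1 else 0) +
        (if ((classify l p q (a i)).1 = .small ∧ l = .q) ∨
          ((classify l p q (a i)).1 = .large ∧ l = .p) then 1 else 0) := by
      cases l <;> simp only [classify] <;> split_ifs <;> simp_all
    simp only [additionalCost] at ih
    simp only [DTree.comparisons, DTree.path, List.length_cons, List.map_cons, List.count_cons,
      additionalCost, List.countP_cons, ih, key, beq_iff_eq, decide_eq_true_eq]
    omega

/-- The sum of the step costs `k x y c` over a sequence of classes with its *last* class `c` at the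
head: `x` and `y` are the numbers of small and of large elements before that step. -/
def stepSum (k : ℕ → ℕ → Cls → ℕ) : List Cls → ℕ
  | [] => 0
  | c :: w => k (w.count .small) (w.count .large) c + stepSum k w

/-- The cost of a step of strategy `L`. -/
def costL (x y : ℕ) (c : Cls) : ℕ :=
  if (c = .small ∧ x ≤ y) ∨ (c = .large ∧ y < x) then 1 else 0

/-- The cost of a step of strategy `O` run backwards, where the numbers of small and of large
elements that are still to come before the step are `x + 1, y` or `x, y + 1` in forward time. -/
def costO (x y : ℕ) (c : Cls) : ℕ :=
  if (c = .small ∧ x < y) ∨ (c = .large ∧ y + 1 < x) then 1 else 0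

theorem ruleCost_ruleL (w : List Cls) :
    ruleCost ruleL 0 0 w = stepSum costL w.reverse := by
  have gen : ∀ w u : List Cls, ruleCost ruleL (u.count .small) (u.count .large) w +
      stepSum costL u = stepSum costL (w.reverse ++ u) := by
    intro w
    induction w with
    | nil => intro u; simp [ruleCost]
    | cons c w ih =>
      intro u
      have := ih (c :: u)
      rw [List.reverse_cons, List.append_assoc, List.singleton_append, ← this]
      simp only [ruleCost, stepSum, List.count_cons, beq_iff_eq, costL, ruleL]
      have e : ((c = .small ∧ (if u.count .small > u.count .large then Pivot.p else .q) = .q) ∨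
          (c = .large ∧ (if u.count .small > u.count .large then Pivot.p else .q) = .p)) ↔
          ((c = .small ∧ u.count .small ≤ u.count .large) ∨
            (c = .large ∧ u.count .large < u.count .small)) := by
        split_ifs with h <;> cases c <;> simp <;> omega
      simp only [e]
      omega
  simpa [stepSum] using gen w []

/-- Strategy `O` looks at what remains of the sequence, so that its cost is a sum of step costs of
the sequence read backwards. -/
theorem ruleCost_ruleO {s l : ℕ} (w : List Cls) : ∀ {sv lv : ℕ}, s = sv + w.count .small →
    l = lv + w.count .large → ruleCost (ruleO s l) sv lv w = stepSum costO w := by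
  induction w with
  | nil => intros; rfl
  | cons c w ih =>
    intro sv lv hs hl
    simp only [List.count_cons, beq_iff_eq] at hs hl
    simp only [ruleCost, stepSum, costO, ruleO]
    rw [ih (by omega) (by omega)]
    congr 2
    rw [eq_iff_iff]
    split_ifs with h <;> cases c <;> simp at * <;> omega

/-! ### Random sequences of classes -/

/-- All sequences of classes of length `N`. -/
def words : ℕ → Finset (List Cls)
  | 0 => {[]}
  | N + 1 => (Finset.univ ×ˢ words N).map
      ⟨fun x => x.1 :: x.2, fun x y h => by
        rw [List.cons_eq_cons] at h; exact Prod.ext h.1 h.2⟩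

theorem mem_words {N : ℕ} {w : List Cls} : w ∈ words N ↔ w.length = N := by
  induction N generalizing w with
  | zero => simp [words]
  | succ N ih =>
    cases w with
    | nil => simp [words]
    | cons c w =>
      rw [words, Finset.mem_map, List.length_cons, Nat.add_right_cancel_iff, ← ih]
      constructor
      · rintro ⟨⟨b, u⟩, hu, h⟩
        obtain ⟨-, rfl⟩ := List.cons_eq_cons.1 h
        exact (Finset.mem_product.1 hu).2
      · exact fun h => ⟨(c, w), Finset.mem_product.2 ⟨Finset.mem_univ _, h⟩, rfl⟩

theorem sum_words_succ {M : Type*} [AddCommMonoid M] (N : ℕ) (f : List Cls → M) :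
    ∑ w ∈ words (N + 1), f w = ∑ w ∈ words N, ∑ c, f (c :: w) := by
  rw [words, Finset.sum_map, Finset.sum_product_right]
  rfl

open Nat in
/-- The probability that a sequence `w` of classes shows up when `w.length + 2` elements in random
order are classified with respect to two of them. -/
noncomputable def weight (w : List Cls) : ℝ :=
  2 * (w.count .small)! * (w.count .medium)! * (w.count .large)! / (w.length + 2)!

theorem weight_reverse (w : List Cls) : weight w.reverse = weight w := by simp [weight]

/-- The weights are those of Pólya's urn with three colours. -/
theorem weight_cons (c : Cls) (w : List Cls) :
    weight (c :: w) = weight w * ((w.count c + 1) / (w.length + 3)) := by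
  have h : ((w.length : ℝ) + 3) ≠ 0 := by positivity
  have h2 : (((w.length + 2).factorial : ℕ) : ℝ) ≠ 0 := by positivity
  have e : w.length + 1 + 2 = (w.length + 2) + 1 := by ring
  cases c <;> simp only [weight, List.count_cons, List.length_cons, e, Nat.factorial_succ] <;>
    simp [Nat.factorial_succ] <;> field_simp <;> ring

/-- The expected value of `f` of the classes of `N` non-pivot elements. -/
noncomputable def mean (N : ℕ) (f : List Cls → ℝ) : ℝ := ∑ w ∈ words N, weight w * f w

theorem mean_add (N : ℕ) (f g : List Cls → ℝ) :
    mean N (fun w => f w + g w) = mean N f + mean N g := by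
  simp [mean, mul_add, Finset.sum_add_distrib]

theorem mean_congr {N : ℕ} {f g : List Cls → ℝ} (h : ∀ w, w.length = N → f w = g w) :
    mean N f = mean N g :=
  Finset.sum_congr rfl fun w hw => by rw [h w (mem_words.1 hw)]

theorem mean_reverse (N : ℕ) (f : List Cls → ℝ) :
    mean N (fun w => f w.reverse) = mean N f := by
  refine Finset.sum_nbij' List.reverse List.reverse ?_ ?_ ?_ ?_ ?_ <;>
    simp [mem_words, weight_reverse]

theorem mean_succ (N : ℕ) (f : List Cls → ℝ) :
    mean (N + 1) f = mean N fun w => ∑ c, ((w.count c : ℝ) + 1) / (N + 3) * f (c :: w) := by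
  rw [mean, sum_words_succ]
  refine Finset.sum_congr rfl fun w hw => ?_
  rw [Finset.mul_sum]
  refine Finset.sum_congr rfl fun c _ => ?_
  rw [weight_cons, mem_words.1 hw, mul_assoc]

theorem sum_urn {N : ℕ} {w : List Cls} (hw : w.length = N) :
    ∑ c, ((w.count c : ℝ) + 1) / (N + 3) = 1 := by
  have h : (w.count .small : ℝ) + w.count .medium + w.count .large = N := by
    rw [← hw]; exact_mod_cast count_cls w
  have h' : (N : ℝ) + 3 ≠ 0 := by positivity
  rw [sum_cls, ← add_div, ← add_div, div_eq_one_iff_eq h', ← h]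
  ring

theorem mean_stepSum_succ (k : ℕ → ℕ → Cls → ℕ) (N : ℕ) :
    mean (N + 1) (fun w => (stepSum k w : ℝ)) = mean N (fun w => (stepSum k w : ℝ)) +
      mean N fun w => ∑ c, ((w.count c : ℝ) + 1) / (N + 3) *
        k (w.count .small) (w.count .large) c := by
  rw [mean_succ, ← mean_add]
  refine mean_congr fun w hw => ?_
  simp only [stepSum, Nat.cast_add, mul_add, Finset.sum_add_distrib]
  rw [← Finset.sum_mul, sum_urn hw, one_mul, add_comm]

theorem mean_stepSum (k : ℕ → ℕ → Cls → ℕ) (N : ℕ) :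
    mean N (fun w => (stepSum k w : ℝ)) = ∑ t ∈ Finset.range N,
      mean t fun w => ∑ c, ((w.count c : ℝ) + 1) / (t + 3) *
        k (w.count .small) (w.count .large) c := by
  induction N with
  | zero => simp [mean, words, stepSum]
  | succ N ih => rw [mean_stepSum_succ, ih, Finset.sum_range_succ]

/-! ### The classes of a random permutation -/

/-- The permutations that carry the fibres of `D` to the fibres of `V` form a coset of the
stabilizer of `D`. -/
theorem card_filter_perm_comp_eq {α ι : Type*} [Fintype α] [DecidableEq α] [Fintype ι]
    [DecidableEq ι] (V D : α → ι) [DecidablePred fun σ : Equiv.Perm α => ∀ i, V (σ i) = D i]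
    (h : ∀ c, (Finset.univ.filter fun a => V a = c).card =
      (Finset.univ.filter fun a => D a = c).card) :
    (Finset.univ.filter fun σ : Equiv.Perm α => ∀ i, V (σ i) = D i).card =
      ∏ c, (Finset.univ.filter fun a => D a = c).card.factorial := by
  have e : ∀ c, Nonempty ({a // D a = c} ≃ {a // V a = c}) := fun c => by
    refine ⟨Fintype.equivOfCardEq ?_⟩
    rw [Fintype.card_subtype, Fintype.card_subtype, h]
  let σ₀ : Equiv.Perm α := Equiv.ofFiberEquiv fun c => (e c).some
  have hσ₀ : ∀ a, V (σ₀ a) = D a := Equiv.ofFiberEquiv_map _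
  have hs := DomMulAct.stabilizer_card D
  simp only [Fintype.card_subtype] at hs
  rw [← hs]
  refine Finset.card_nbij' (fun σ => σ₀⁻¹ * σ) (fun g => σ₀ * g) ?_ ?_ ?_ ?_
  · intro σ hσ
    simp only [Finset.coe_filter, Finset.mem_univ, true_and, Set.mem_ofPred_eq] at hσ ⊢
    funext i
    rw [← hσ i, Function.comp_apply, ← hσ₀]
    simp
  · intro g hg
    simp only [Finset.coe_filter, Finset.mem_univ, true_and, Set.mem_ofPred_eq] at hg ⊢
    intro i
    rw [Equiv.Perm.mul_apply, hσ₀]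
    exact congrFun hg i
  · intro σ _; simp
  · intro g _; simp

theorem card_filter_fin_succ (n : ℕ) (P : ℕ → Prop) [DecidablePred P] :
    (Finset.univ.filter fun i : Fin n => P (i + 1)).card = ((Finset.Icc 1 n).filter P).card := by
  have : Finset.Icc 1 n = Finset.Ico 1 (n + 1) := rfl
  rw [Finset.card_filter, Finset.card_filter, this, Finset.sum_Ico_eq_sum_range,
    Finset.sum_range, Nat.add_sub_cancel]
  simp only [add_comm 1]

/-- The class of a value, `none` for the pivots. -/
def optCls (p q x : ℕ) : Option Cls := if x = p ∨ x = q then none else some (clsOf p q x)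

/-- The number of elements of each class in a permutation of `{1, …, n}` with pivots `p < q`. -/
def groupSize (n p q : ℕ) : Cls → ℕ
  | .small => p - 1
  | .medium => q - p - 1
  | .large => n - q

/-- The values of each class in a permutation of `{1, …, n}` with pivots `p < q`. -/
def group (n p q : ℕ) : Cls → Finset ℕ
  | .small => Finset.Ico 1 p
  | .medium => Finset.Ioo p q
  | .large => Finset.Ioc q n

theorem card_group (n p q : ℕ) (c : Cls) : (group n p q c).card = groupSize n p q c := by
  cases c <;> simp [group, groupSize]

theorem mem_group {n p q x : ℕ} (hpq : p < q) (hq : q ≤ n) {c : Cls} :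
    x ∈ group n p q c ↔ x ∈ Finset.Icc 1 n ∧ x ≠ p ∧ x ≠ q ∧ clsOf p q x = c := by
  cases c <;> simp only [group, clsOf, Finset.mem_Icc, Finset.mem_Ico, Finset.mem_Ioo,
    Finset.mem_Ioc] <;> split_ifs <;> simp <;> omega

theorem optCls_eq_some {p q x : ℕ} {c : Cls} :
    optCls p q x = some c ↔ x ≠ p ∧ x ≠ q ∧ clsOf p q x = c := by
  unfold optCls; split_ifs with h <;> simp <;> tauto

theorem optCls_eq_none {p q x : ℕ} : optCls p q x = none ↔ x = p ∨ x = q := by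
  unfold optCls; split_ifs with h <;> simp [h]

theorem card_optCls_some {n p q : ℕ} (hpq : p < q) (hq : q ≤ n) (c : Cls) :
    (Finset.univ.filter fun i : Fin n => optCls p q (i + 1) = some c).card =
      groupSize n p q c := by
  rw [card_filter_fin_succ n fun x => optCls p q x = some c, ← card_group]
  congr 1
  ext x
  rw [Finset.mem_filter, mem_group hpq hq, optCls_eq_some]

theorem card_pair {n p q : ℕ} (hp : 1 ≤ p) (hpq : p < q) (hq : q ≤ n) :
    (Finset.univ.filter fun i : Fin n => (i : ℕ) + 1 = p ∨ (i : ℕ) + 1 = q).card = 2 := by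
  rw [card_filter_fin_succ n fun x => x = p ∨ x = q, ← Finset.card_pair hpq.ne]
  congr 1
  ext x
  simp only [Finset.mem_filter, Finset.mem_Icc, Finset.mem_insert, Finset.mem_singleton]
  omega

section input

variable {n : ℕ} (σ : Equiv.Perm (Fin n))

theorem length_input : (input σ).length = n := by simp [input]

theorem elt_input (i : Fin n) : elt (input σ) (i + 1) = σ i + 1 := by
  simp [elt, input]

theorem elt_input_one (hn : 2 ≤ n) : elt (input σ) 1 = σ ⟨0, by omega⟩ + 1 :=
  elt_input σ ⟨0, by omega⟩

theorem elt_input_last (hn : 2 ≤ n) : elt (input σ) n = σ ⟨n - 1, by omega⟩ + 1 := by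
  have := elt_input σ ⟨n - 1, by omega⟩
  rwa [show ((⟨n - 1, by omega⟩ : Fin n) : ℕ) + 1 = n from Nat.sub_add_cancel (by omega)] at this

theorem pivot_bounds (hn : 2 ≤ n) : 1 ≤ pivotP (input σ) ∧ pivotP (input σ) < pivotQ (input σ) ∧
    pivotQ (input σ) ≤ n := by
  have h : σ ⟨0, by omega⟩ ≠ σ ⟨n - 1, by omega⟩ := by
    rw [Ne, σ.injective.eq_iff, Fin.mk.injEq]; omega
  rw [Ne, Fin.ext_iff] at h
  rw [pivotP, pivotQ, length_input, elt_input_one σ hn, elt_input_last σ hn]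
  omega

theorem eq_pivot_iff (hn : 2 ≤ n) (i : Fin n) :
    ((σ i : ℕ) + 1 = pivotP (input σ) ∨ (σ i : ℕ) + 1 = pivotQ (input σ)) ↔
      (i : ℕ) = 0 ∨ (i : ℕ) + 1 = n := by
  have h1 : (i : ℕ) = 0 ↔ (σ i : ℕ) = σ ⟨0, by omega⟩ := by
    rw [← Fin.ext_iff, σ.injective.eq_iff, Fin.ext_iff]
  have h2 : (i : ℕ) + 1 = n ↔ (σ i : ℕ) = σ ⟨n - 1, by omega⟩ := by
    rw [← Fin.ext_iff, σ.injective.eq_iff, Fin.ext_iff]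
    simp only; omega
  rw [h1, h2, pivotP, pivotQ, length_input, elt_input_one σ hn, elt_input_last σ hn]
  omega

/-- The class of the `i`-th element of the input. -/
def inputCls (i : ℕ) : Cls := clsOf (pivotP (input σ)) (pivotQ (input σ)) (elt (input σ) i)

theorem optCls_input (hn : 2 ≤ n) (i : Fin n) :
    optCls (pivotP (input σ)) (pivotQ (input σ)) (σ i + 1) =
      if (i : ℕ) = 0 ∨ (i : ℕ) + 1 = n then none else some (inputCls σ (i + 1)) := by
  simp only [optCls, eq_pivot_iff σ hn, inputCls, elt_input]

theorem path_input (hn : 2 ≤ n) (t : ClassTree n) :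
    t.tree.path (pivotP (input σ)) (pivotQ (input σ)) (elt (input σ)) =
      t.tree.trace (inputCls σ) := by
  refine DTree.path_eq_trace _ t.covers fun i hi l => ?_
  rw [Finset.mem_Icc] at hi
  have h := eq_pivot_iff σ hn ⟨i - 1, by omega⟩
  rw [← elt_input] at h
  simp only [show i - 1 + 1 = i by omega] at h
  exact classify_fst l (pivot_bounds σ hn).2.1 (fun h' => by have := h.1 (.inl h'); omega)
    (fun h' => by have := h.1 (.inr h'); omega)

end input

theorem card_positions {n : ℕ} (d : ℕ → Cls) (c : Cls) :
    (Finset.univ.filter fun i : Fin n =>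
      (if (i : ℕ) = 0 ∨ (i : ℕ) + 1 = n then none else some (d (i + 1))) = some c).card =
      ((Finset.Icc 2 (n - 1)).filter fun i => d i = c).card := by
  have := card_filter_fin_succ n
    fun i => (if i = 1 ∨ i = n then none else some (d i)) = some c
  simp only [Nat.add_eq_right] at this
  rw [this]
  congr 1
  ext i
  simp only [Finset.mem_filter, Finset.mem_Icc]
  split_ifs with h
  · simp; omega
  · simp only [Option.some.injEq]
    have : 1 ≤ i ∧ i ≤ n ↔ 2 ≤ i ∧ i ≤ n - 1 := by omega
    rw [this]

theorem count_word_input {n : ℕ} (hn : 2 ≤ n) (σ : Equiv.Perm (Fin n)) (t : ClassTree n)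
    (c : Cls) : (t.tree.word (inputCls σ)).count c =
      groupSize n (pivotP (input σ)) (pivotQ (input σ)) c := by
  obtain ⟨-, h2, h3⟩ := pivot_bounds σ hn
  rw [DTree.count_word t.covers, ← card_positions, ← card_optCls_some h2 h3]
  simp only [← optCls_input σ hn]
  exact Finset.card_equiv σ (by simp)

/-- Every sequence of classes comes from equally many permutations, for a fixed number of elements
of each class. -/
theorem card_word_eq {n : ℕ} (hn : 2 ≤ n) (t : ClassTree n) {w : List Cls}
    (hw : w.length = n - 2) :
    (Finset.univ.filter fun σ : Equiv.Perm (Fin n) => t.tree.word (inputCls σ) = w).card =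
      2 * (w.count .small).factorial * (w.count .medium).factorial *
        (w.count .large).factorial := by
  obtain ⟨d, hd⟩ := DTree.exists_word_eq_iff t.tree (w := w) t.covers
    (by rw [hw, Nat.card_Icc]; omega)
  have hcard : ∀ c, ((Finset.Icc 2 (n - 1)).filter fun i => d i = c).card = w.count c := by
    intro c
    rw [← DTree.count_word t.covers, (hd d).2 fun _ _ => rfl]
  have hsum := count_cls w
  set p := w.count .small + 1 with hp
  obtain ⟨q, hq⟩ : ∃ q, q + w.count .large = n := ⟨n - w.count .large, by omega⟩
  have hpq : p < q := by omega
  let D : Fin n → Option Cls := fun i =>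
    if (i : ℕ) = 0 ∨ (i : ℕ) + 1 = n then none else some (d (i + 1))
  have hD : ∀ c, (Finset.univ.filter fun i => D i = some c).card = w.count c := fun c => by
    rw [← hcard, ← card_positions]
  have hD' : (Finset.univ.filter fun i => D i = none).card = 2 := by
    rw [← card_pair (n := n) (p := 1) (q := n) le_rfl (by omega) le_rfl]
    congr 1
    ext i
    simp only [D, Finset.mem_filter, Finset.mem_univ, true_and]
    split_ifs with h <;> simp <;> omega
  have hsize : ∀ c, groupSize n p q c = w.count c := by
    intro c; cases c <;> simp only [groupSize] <;> omega
  have key : ∀ σ : Equiv.Perm (Fin n), t.tree.word (inputCls σ) = w ↔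
      ∀ i, optCls p q (σ i + 1) = D i := by
    intro σ
    obtain ⟨h1, h2, h3⟩ := pivot_bounds σ hn
    have hmid : pivotP (input σ) = p → pivotQ (input σ) = q →
        ((∀ i ∈ Finset.Icc 2 (n - 1), inputCls σ i = d i) ↔
          ∀ i, optCls p q (σ i + 1) = D i) := by
      intro e1 e2
      have := optCls_input σ hn
      rw [e1, e2] at this
      simp only [this, D]
      constructor
      · intro h i
        split_ifs with hi
        · rfl
        · rw [h _ (Finset.mem_Icc.2 (by omega))]
      · intro h i hi
        rw [Finset.mem_Icc] at hi
        have := h ⟨i - 1, by omega⟩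
        simp only [show i - 1 + 1 = i by omega] at this
        rw [if_neg (by omega), if_neg (by omega)] at this
        simpa using this
    constructor
    · intro h
      have c1 := count_word_input hn σ t .small
      have c2 := count_word_input hn σ t .large
      rw [h] at c1 c2
      simp only [groupSize] at c1 c2
      exact (hmid (by omega) (by omega)).1 ((hd _).1 h)
    · intro h
      have h0 := h ⟨0, by omega⟩
      have hl := h ⟨n - 1, by omega⟩
      simp only [D, true_or, if_true] at h0
      simp only [D, if_pos (show n - 1 = 0 ∨ n - 1 + 1 = n by omega)] at hl
      rw [optCls_eq_none, ← elt_input_one σ hn] at h0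
      rw [optCls_eq_none, ← elt_input_last σ hn] at hl
      have hp' : pivotP (input σ) = p ∧ pivotQ (input σ) = q := by
        rw [pivotP, pivotQ, length_input] at *
        omega
      exact (hd _).2 ((hmid hp'.1 hp'.2).2 h)
  simp only [key]
  rw [card_filter_perm_comp_eq (fun i : Fin n => optCls p q (i + 1)) D]
  · rw [Fintype.prod_option, hD']
    have : (Finset.univ : Finset Cls) = {.small, .medium, .large} := rfl
    rw [this, Finset.prod_insert (by decide), Finset.prod_insert (by decide),
      Finset.prod_singleton, hD, hD, hD]
    simp [Nat.factorial, mul_assoc]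
  · rintro (_ | c)
    · rw [hD', ← card_pair (n := n) (by omega : 1 ≤ p) hpq (by omega)]
      simp only [optCls_eq_none]
    · rw [hD, card_optCls_some hpq (by omega), hsize]

theorem card_pivots_eq {n s l : ℕ} (h : s + l + 2 ≤ n) :
    (Finset.univ.filter fun σ : Equiv.Perm (Fin n) =>
      pivotP (input σ) = s + 1 ∧ pivotQ (input σ) + l = n).card = 2 * (n - 2).factorial := by
  have hn : 2 ≤ n := by omega
  obtain ⟨q, hq⟩ : ∃ q, q + l = n := ⟨n - l, by omega⟩
  let V : Fin n → Bool := fun i => decide ((i : ℕ) + 1 = s + 1 ∨ (i : ℕ) + 1 = q)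
  let D : Fin n → Bool := fun i => decide ((i : ℕ) + 1 = 1 ∨ (i : ℕ) + 1 = n)
  have hV : ∀ {m m' : ℕ}, 1 ≤ m → m < m' → m' ≤ n → ∀ b, (Finset.univ.filter fun i : Fin n =>
      decide ((i : ℕ) + 1 = m ∨ (i : ℕ) + 1 = m') = b).card = bif b then 2 else n - 2 := by
    intro m m' h1 h2 h3 b
    have := card_pair h1 h2 h3
    cases b
    · simp only [decide_eq_false_iff_not, cond_false]
      rw [← Finset.compl_filter, Finset.card_compl, this, Fintype.card_fin]
    · simpa using this
  have key : ∀ σ : Equiv.Perm (Fin n), (pivotP (input σ) = s + 1 ∧ pivotQ (input σ) + l = n) ↔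
      ∀ i, V (σ i) = D i := by
    intro σ
    obtain ⟨h1, h2, h3⟩ := pivot_bounds σ hn
    constructor
    · rintro ⟨e1, e2⟩ i
      have := eq_pivot_iff σ hn i
      rw [e1, show pivotQ (input σ) = q by omega] at this
      simp only [V, D, this, Nat.add_eq_right]
    · intro h
      simp only [V, D, decide_eq_decide] at h
      have h0 := (h ⟨0, by omega⟩).2 (.inl rfl)
      have hl := (h ⟨n - 1, by omega⟩).2 (.inr (Nat.sub_add_cancel (by omega)))
      rw [← elt_input_one σ hn] at h0
      rw [← elt_input_last σ hn] at hl
      rw [pivotP, pivotQ, length_input] at *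
      omega
  simp only [key]
  rw [card_filter_perm_comp_eq V D]
  · rw [Fintype.prod_bool, hV le_rfl (by omega) le_rfl, hV le_rfl (by omega) le_rfl]
    simp
  · intro b
    rw [hV le_rfl (by omega) le_rfl, hV (by omega) (by omega) (by omega)]

/-! ### Expectations over random permutations -/

/-- The average of `φ s l` over the pairs with `s + l ≤ n - 2`. -/
noncomputable def pairMean (n : ℕ) (φ : ℕ → ℕ → ℝ) : ℝ :=
  1 / (n.choose 2 : ℝ) * ∑ s ∈ Finset.range (n - 1), ∑ l ∈ Finset.range (n - 1 - s), φ s l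

theorem pairMean_congr {n : ℕ} {φ ψ : ℕ → ℕ → ℝ} (hn : 2 ≤ n)
    (h : ∀ s l, s + l ≤ n - 2 → φ s l = ψ s l) : pairMean n φ = pairMean n ψ := by
  unfold pairMean
  congr 1
  refine Finset.sum_congr rfl fun s hs => Finset.sum_congr rfl fun l hl => h s l ?_
  rw [Finset.mem_range] at hs hl
  omega

theorem factorial_eq_choose_two {n : ℕ} (hn : 2 ≤ n) :
    (n.factorial : ℝ) = n.choose 2 * (2 * (n - 2).factorial : ℕ) := by
  rw [← Nat.choose_mul_factorial_mul_factorial hn]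
  push_cast
  simp [mul_assoc]

theorem sum_perm_eq_sum_pivots {n : ℕ} (hn : 2 ≤ n) (F : Equiv.Perm (Fin n) → ℝ) :
    ∑ σ, F σ = ∑ s ∈ Finset.range (n - 1), ∑ l ∈ Finset.range (n - 1 - s),
      ∑ σ with pivotP (input σ) = s + 1 ∧ pivotQ (input σ) + l = n, F σ := by
  rw [Finset.sum_sigma', ← Finset.sum_fiberwise_of_maps_to
    (g := fun σ => (⟨pivotP (input σ) - 1, n - pivotQ (input σ)⟩ : (_ : ℕ) × ℕ))
    (t := (Finset.range (n - 1)).sigma fun s => Finset.range (n - 1 - s))]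
  · refine Finset.sum_congr rfl fun x _ => Finset.sum_congr ?_ fun _ _ => rfl
    ext σ
    have := pivot_bounds σ hn
    obtain ⟨s, l⟩ := x
    simp only [Finset.mem_filter, Finset.mem_univ, true_and, Sigma.mk.injEq, heq_eq_eq]
    omega
  · intro σ _
    have := pivot_bounds σ hn
    simp only [Finset.mem_sigma, Finset.mem_range]
    omega

/-- All pairs of pivots are equally likely. -/
theorem pairMean_expect {n : ℕ} (hn : 2 ≤ n) (g : ℕ → ℕ → Equiv.Perm (Fin n) → ℝ) :
    pairMean n (fun s l =>
        𝔼 σ : Equiv.Perm (Fin n) with pivotP (input σ) = s + 1 ∧ pivotQ (input σ) + l = n, g s l σ) =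
      𝔼 σ, g (pivotP (input σ) - 1) (n - pivotQ (input σ)) σ := by
  have hc : (n.choose 2 : ℝ) ≠ 0 := by
    have := Nat.choose_pos hn
    positivity
  have hf : ((2 * (n - 2).factorial : ℕ) : ℝ) ≠ 0 := by positivity
  have key : ∀ s l, s + l ≤ n - 2 →
      (𝔼 σ : Equiv.Perm (Fin n) with pivotP (input σ) = s + 1 ∧ pivotQ (input σ) + l = n, g s l σ) =
      (∑ σ : Equiv.Perm (Fin n) with pivotP (input σ) = s + 1 ∧ pivotQ (input σ) + l = n,
        g (pivotP (input σ) - 1) (n - pivotQ (input σ)) σ) / (2 * (n - 2).factorial : ℕ) := by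
    intro s l h
    rw [Finset.expect_eq_sum_div_card, card_pivots_eq (by omega)]
    congr 1
    refine Finset.sum_congr rfl fun σ hσ => ?_
    have := (Finset.mem_filter.1 hσ).2
    rw [show pivotP (input σ) - 1 = s by omega, show n - pivotQ (input σ) = l by omega]
  rw [pairMean_congr hn key, pairMean, Finset.expect_eq_sum_div_card, sum_perm_eq_sum_pivots hn,
    Finset.card_univ, Fintype.card_perm, Fintype.card_fin, factorial_eq_choose_two hn]
  simp only [← Finset.sum_div]
  field_simp

theorem pairMean_eq_expect {n : ℕ} (hn : 2 ≤ n) (φ : ℕ → ℕ → ℝ) :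
    pairMean n φ = 𝔼 σ : Equiv.Perm (Fin n), φ (pivotP (input σ) - 1) (n - pivotQ (input σ)) := by
  rw [← pairMean_expect hn fun s l _ => φ s l]
  refine pairMean_congr hn fun s l h => (Finset.expect_const ?_ _).symm
  rw [← Finset.card_pos, card_pivots_eq (by omega)]
  positivity

/-- The classes of a random permutation, in the order of inspection, are distributed according to
`weight`, even if the tree depends on the numbers of small and large elements. -/
theorem expect_word {n : ℕ} (hn : 2 ≤ n) (T : ℕ → ℕ → ClassTree n) (f : List Cls → ℝ) :
    𝔼 σ : Equiv.Perm (Fin n), f ((T (pivotP (input σ) - 1)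
      (n - pivotQ (input σ))).tree.word (inputCls σ)) = mean (n - 2) f := by
  rw [Finset.expect_eq_sum_div_card, Finset.card_univ, Fintype.card_perm, Fintype.card_fin, mean,
    ← Finset.sum_fiberwise_of_maps_to (t := words (n - 2))
      (g := fun σ : Equiv.Perm (Fin n) => (T (pivotP (input σ) - 1)
        (n - pivotQ (input σ))).tree.word (inputCls σ)), Finset.sum_div]
  · refine Finset.sum_congr rfl fun w hw => ?_
    rw [Finset.sum_congr rfl fun σ hσ => congrArg f (Finset.mem_filter.1 hσ).2, Finset.sum_const]
    have : (Finset.univ.filter fun σ : Equiv.Perm (Fin n) => (T (pivotP (input σ) - 1)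
        (n - pivotQ (input σ))).tree.word (inputCls σ) = w) =
        Finset.univ.filter fun σ : Equiv.Perm (Fin n) =>
          (T (w.count .small) (w.count .large)).tree.word (inputCls σ) = w := by
      ext σ
      have h1 := fun t => count_word_input hn σ t .small
      have h2 := fun t => count_word_input hn σ t .large
      simp only [groupSize] at h1 h2
      simp only [Finset.mem_filter, Finset.mem_univ, true_and]
      constructor
      · intro h
        rw [← h, h1, h2]
      · intro h
        have e1 := h1 (T (w.count .small) (w.count .large))
        have e2 := h2 (T (w.count .small) (w.count .large))
        rw [h] at e1 e2
        rwa [← e1, ← e2]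
    rw [mem_words] at hw
    rw [this, card_word_eq hn _ hw, weight, hw, Nat.sub_add_cancel hn, nsmul_eq_mul]
    push_cast
    ring
  · intro σ _
    rw [mem_words, DTree.length_word (ClassTree.covers _), Nat.card_Icc]
    omega

theorem mean_counts (t : ℕ) (φ : ℕ → ℕ → ℝ) :
    mean t (fun w => φ (w.count .small) (w.count .large)) = pairMean (t + 2) φ := by
  obtain ⟨T, -⟩ := exists_implements (t + 2) ruleL
  have hn : 2 ≤ t + 2 := by omega
  rw [pairMean_eq_expect hn, show t = t + 2 - 2 from rfl, ← expect_word hn fun _ _ => T]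
  refine Finset.expect_congr rfl fun σ _ => ?_
  rw [count_word_input hn, count_word_input hn]
  rfl

theorem ACT_eq_pairMean (n : ℕ) (T : ℕ → ℕ → ClassTree n) :
    ACT n T = pairMean n fun s l => condCost (T s l) s l := rfl

theorem ACT_eq_mean_costL {n : ℕ} (hn : 2 ≤ n) {t : ClassTree n} (ht : t.Implements ruleL) :
    ACT n (fun _ _ => t) = mean (n - 2) fun w => (stepSum costL w : ℝ) := by
  rw [ACT_eq_pairMean]
  simp only [condCost]
  rw [pairMean_expect hn fun _ _ σ => (additionalCost (t.tree.path (pivotP (input σ))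
    (pivotQ (input σ)) (elt (input σ))) : ℝ), ← mean_reverse, ← expect_word hn fun _ _ => t]
  refine Finset.expect_congr rfl fun σ _ => ?_
  rw [path_input σ hn, additionalCost_trace _ ht, ruleCost_ruleL]

theorem ACT_eq_mean_costO {n : ℕ} (hn : 2 ≤ n) {T : ℕ → ℕ → ClassTree n}
    (hT : ∀ s l : ℕ, s + l ≤ n - 2 → (T s l).Implements (ruleO s l)) :
    ACT n T = mean (n - 2) fun w => (stepSum costO w : ℝ) := by
  rw [ACT_eq_pairMean]
  simp only [condCost]
  rw [pairMean_expect hn fun s l σ => (additionalCost ((T s l).tree.path (pivotP (input σ))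
    (pivotQ (input σ)) (elt (input σ))) : ℝ), ← expect_word hn T]
  refine Finset.expect_congr rfl fun σ _ => ?_
  have hb := pivot_bounds σ hn
  rw [path_input σ hn, additionalCost_trace _ (hT _ _ (by omega)),
    ruleCost_ruleO _ (by rw [count_word_input hn, zero_add]; rfl)
      (by rw [count_word_input hn, zero_add]; rfl)]

theorem expect_additionalCost {n : ℕ} (hn : 2 ≤ n) {t : ClassTree n} (ht : t.Implements ruleL) :
    𝔼 σ : Equiv.Perm (Fin n), (additionalCost (t.tree.path (pivotP (input σ))
      (pivotQ (input σ)) (elt (input σ))) : ℝ) = mean (n - 2) fun w => (stepSum costL w : ℝ) := by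
  rw [← ACT_eq_mean_costL hn ht, ACT_eq_pairMean]
  simp only [condCost]
  rw [pairMean_expect hn fun _ _ σ => (additionalCost (t.tree.path (pivotP (input σ))
    (pivotQ (input σ)) (elt (input σ))) : ℝ)]

/-! ### The recurrence for the average number of comparisons -/

namespace DTree

theorem path_congr {p q p' q' : ℕ} {a a' : ℕ → ℕ} (t : DTree) :
    ∀ {S : Finset ℕ}, t.Covers S →
      (∀ i ∈ S, ∀ l, (classify l p q (a i)).1 = (classify l p' q' (a' i)).1) →
      t.path p q a = t.path p' q' a' := by
  induction t with
  | leaf => intro S _ _; rfl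
  | node i l child ih =>
    intro S h hd
    simp only [path, hd i h.1 l]
    rw [ih _ (h.2 _) fun j hj => hd j (Finset.mem_of_mem_erase hj)]

theorem idx_mem_of_mem_path {p q : ℕ} {a : ℕ → ℕ} {v : Step} (t : DTree) :
    ∀ {S : Finset ℕ}, t.Covers S → v ∈ t.path p q a → v.idx ∈ S := by
  induction t with
  | leaf => intro S _ hv; simp [path] at hv
  | node i l child ih =>
    intro S h hv
    rcases List.mem_cons.1 hv with rfl | hv
    · exact h.1
    · exact Finset.mem_of_mem_erase (ih _ (h.2 _) hv)

end DTree

theorem elt_map (g : ℕ → ℕ) {xs : List ℕ} {i : ℕ} (h1 : 1 ≤ i) (h2 : i ≤ xs.length) :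
    elt (xs.map g) i = g (elt xs i) := by
  have : i - 1 < xs.length := by omega
  simp [elt, this]

section quicksort

variable (T : ∀ n, ClassTree n) (R : Arrangement)

/-- The path taken in the classification tree. -/
def classPath (xs : List ℕ) : List Step :=
  (T xs.length).tree.path (pivotP xs) (pivotQ xs) (elt xs)

/-- The subarray of the elements of class `c`. -/
def subarray (xs : List ℕ) (c : Cls) : List ℕ := (R.arrange (classPath T xs) c).map (elt xs)

theorem mem_arrange {π : List Step} {c : Cls} {i : ℕ} :
    i ∈ R.arrange π c ↔ ∃ v ∈ π, v.cls = c ∧ v.idx = i := by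
  simp [(R.perm π c).mem_iff, and_assoc]

theorem mem_arrange_classPath {xs : List ℕ} {c : Cls} {i : ℕ}
    (h : i ∈ R.arrange (classPath T xs) c) : 1 ≤ i ∧ i ≤ xs.length := by
  obtain ⟨v, hv, -, rfl⟩ := (mem_arrange R).1 h
  have := Finset.mem_Icc.1 (DTree.idx_mem_of_mem_path _ (T xs.length).covers hv)
  omega

theorem subarray_length_lt {xs : List ℕ} (h : ¬ xs.length ≤ 1) (c : Cls) :
    (subarray T R xs c).length < xs.length := by
  rw [subarray, List.length_map]
  exact R.length_lt _ h _ _ _ _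

theorem quicksort_snd {xs : List ℕ} (h : ¬ xs.length ≤ 1) : (quicksort T R xs).2 =
    1 + ((classPath T xs).length + ((classPath T xs).map Step.cls).count .medium +
      additionalCost (classPath T xs)) + ∑ c, (quicksort T R (subarray T R xs c)).2 := by
  rw [quicksort, dif_neg h, sum_cls, classPath, ← comparisons_eq]
  simp only [subarray, classPath]
  ring

theorem quicksort_snd_of_le {xs : List ℕ} (h : xs.length ≤ 1) : (quicksort T R xs).2 = 0 := by
  rw [quicksort, dif_pos h]

/-- Only the outcomes of the comparisons with the pivots matter for the path and for the order in
which the subarrays are arranged. -/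
theorem classPath_map {g : ℕ → ℕ} {xs : List ℕ} (hP : pivotP (xs.map g) = g (pivotP xs))
    (hQ : pivotQ (xs.map g) = g (pivotQ xs))
    (h : ∀ x l, (classify l (g (pivotP xs)) (g (pivotQ xs)) (g x)).1 =
      (classify l (pivotP xs) (pivotQ xs) x).1) : classPath T (xs.map g) = classPath T xs := by
  rw [classPath, classPath, hP, hQ, List.length_map]
  refine DTree.path_congr _ (T xs.length).covers fun i hi l => ?_
  rw [Finset.mem_Icc] at hi
  rw [elt_map g (by omega) (by omega), h]

theorem subarray_map {g : ℕ → ℕ} {xs : List ℕ} (h : classPath T (xs.map g) = classPath T xs)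
    (c : Cls) : subarray T R (xs.map g) c = (subarray T R xs c).map g := by
  rw [subarray, subarray, h, List.map_map]
  refine List.map_congr_left fun i hi => ?_
  obtain ⟨h1, h2⟩ := mem_arrange_classPath T R hi
  exact elt_map g h1 h2

/-- Quicksort is comparison based: it depends on the relative order of the elements only. -/
theorem quicksort_map_snd {g : ℕ → ℕ} (hg : StrictMono g) (xs : List ℕ) :
    (quicksort T R (xs.map g)).2 = (quicksort T R xs).2 := by
  induction hm : xs.length using Nat.strong_induction_on generalizing xs with
  | _ m ih =>
    subst hm
    by_cases h : xs.length ≤ 1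
    · rw [quicksort_snd_of_le T R h, quicksort_snd_of_le T R (by rwa [List.length_map])]
    · have hpath : classPath T (xs.map g) = classPath T xs := by
        refine classPath_map T ?_ ?_ fun x l => ?_
        · rw [pivotP, pivotP, List.length_map, elt_map g le_rfl (by omega),
            elt_map g (by omega) le_rfl, hg.monotone.map_min]
        · rw [pivotQ, pivotQ, List.length_map, elt_map g le_rfl (by omega),
            elt_map g (by omega) le_rfl, hg.monotone.map_max]
        · cases l <;> simp [classify, hg.lt_iff_lt]
      rw [quicksort_snd T R h, quicksort_snd T R (by rwa [List.length_map]), hpath]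
      congr 1
      refine Finset.sum_congr rfl fun c _ => ?_
      rw [subarray_map T R hpath]
      exact ih _ (subarray_length_lt T R h c) _ rfl

end quicksort

theorem sum_eq_sum_permutations {α ι M : Type*} [DecidableEq α] [Fintype ι] [AddCommMonoid M]
    {ys : List α} (hys : ys.Nodup) {m : ι → List α} (hinj : Function.Injective m)
    (hm : ∀ i, (m i).Perm ys) (hcard : Fintype.card ι = ys.length.factorial)
    (h : List α → M) : ∑ i, h (m i) = ∑ zs ∈ ys.permutations.toFinset, h zs := by
  have : Finset.univ.map ⟨m, hinj⟩ = ys.permutations.toFinset := by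
    refine Finset.eq_of_subset_of_card_le (fun zs hz => ?_) ?_
    · obtain ⟨i, -, rfl⟩ := Finset.mem_map.1 hz
      exact List.mem_toFinset.2 (List.mem_permutations.2 (hm i))
    · rw [List.toFinset_card_of_nodup (List.nodup_permutations _ hys), List.length_permutations,
        Finset.card_map, Finset.card_univ, hcard]
  rw [← this, Finset.sum_map]
  rfl

theorem nodup_input {n : ℕ} (σ : Equiv.Perm (Fin n)) : (input σ).Nodup := by
  refine List.nodup_ofFn.2 fun i j h => σ.injective (Fin.ext ?_)
  simpa using h

theorem toFinset_input {n : ℕ} (σ : Equiv.Perm (Fin n)) :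
    (input σ).toFinset = Finset.Icc 1 n := by
  refine Finset.eq_of_subset_of_card_le (fun x hx => ?_) ?_
  · obtain ⟨i, rfl⟩ := (List.mem_ofFn' _ _).1 (List.mem_toFinset.1 hx)
    simp only [Finset.mem_Icc]
    omega
  · rw [List.toFinset_card_of_nodup (nodup_input σ), length_input]
    simp

theorem input_perm {n : ℕ} (σ : Equiv.Perm (Fin n)) : (input σ).Perm (List.range' 1 n) := by
  refine List.perm_of_nodup_nodup_toFinset_eq (nodup_input σ) (List.nodup_range') ?_
  ext x
  rw [toFinset_input, List.mem_toFinset, List.mem_range'_1, Finset.mem_Icc]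
  omega

theorem input_injective (n : ℕ) : Function.Injective (input (n := n)) := by
  intro σ τ h
  ext i
  have := elt_input σ i
  rw [h, elt_input] at this
  omega

theorem sum_input {n : ℕ} {M : Type*} [AddCommMonoid M] (h : List ℕ → M) :
    ∑ σ : Equiv.Perm (Fin n), h (input σ) =
      ∑ zs ∈ (List.range' 1 n).permutations.toFinset, h zs :=
  sum_eq_sum_permutations List.nodup_range' (input_injective n) input_perm
    (by rw [Fintype.card_perm, Fintype.card_fin, List.length_range']) h

theorem mem_permutations_range' {n : ℕ} {xs : List ℕ} :
    xs ∈ (List.range' 1 n).permutations.toFinset ↔ ∃ σ : Equiv.Perm (Fin n), input σ = xs := by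
  have := sum_input (n := n) fun zs => ({zs} : Multiset (List ℕ))
  constructor
  · intro h
    have h1 : xs ∈ ∑ zs ∈ (List.range' 1 n).permutations.toFinset, ({zs} : Multiset (List ℕ)) :=
      Multiset.mem_sum.2 ⟨xs, h, Multiset.mem_singleton_self _⟩
    rw [← this] at h1
    obtain ⟨σ, -, h2⟩ := Multiset.mem_sum.1 h1
    exact ⟨σ, (Multiset.mem_singleton.1 h2).symm⟩
  · rintro ⟨σ, rfl⟩
    exact List.mem_toFinset.2 (List.mem_permutations.2 (input_perm σ))

/-- Averaging over all permutations of the values in a set `A` turns a fixed arrangement of `A`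
into a random one. -/
theorem sum_map_ofSubtype {A : Finset ℕ} {ys : List ℕ} (hys : ys.Nodup) (hA : ys.toFinset = A)
    {M : Type*} [AddCommMonoid M] (h : List ℕ → M) :
    ∑ τ : Equiv.Perm {x // x ∈ A}, h (ys.map (Equiv.Perm.ofSubtype τ)) =
      ∑ zs ∈ ys.permutations.toFinset, h zs := by
  have hmem : ∀ x, x ∈ ys ↔ x ∈ A := fun x => by rw [← hA, List.mem_toFinset]
  refine sum_eq_sum_permutations hys (m := fun τ : Equiv.Perm {x // x ∈ A} =>
    ys.map (Equiv.Perm.ofSubtype τ)) (fun τ τ' hτ => ?_) (fun τ => ?_) ?_ h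
  · ext x
    have := List.map_inj_left.1 hτ x ((hmem x).2 x.2)
    simpa using this
  · refine (List.perm_ext_iff_of_nodup (hys.map (Equiv.injective _)) hys).2 fun x => ?_
    rw [List.mem_map, hmem]
    constructor
    · rintro ⟨y, hy, rfl⟩
      rw [hmem] at hy
      rw [Equiv.Perm.ofSubtype_apply_of_mem τ hy]
      exact (τ _).2
    · intro hx
      refine ⟨τ.symm ⟨x, hx⟩, (hmem _).2 (τ.symm _).2, ?_⟩
      rw [Equiv.Perm.ofSubtype_apply_coe, Equiv.apply_symm_apply]
  · rw [Fintype.card_perm, Fintype.card_coe, ← hA, List.toFinset_card_of_nodup hys]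

theorem avgComparisons_eq (T : ∀ n, ClassTree n) (R : Arrangement) (k : ℕ) :
    (k.factorial : ℝ) * avgComparisons T R k =
      ∑ σ : Equiv.Perm (Fin k), ((quicksort T R (input σ)).2 : ℝ) := by
  rw [avgComparisons, Finset.expect_eq_sum_div_card, Finset.card_univ, Fintype.card_perm,
    Fintype.card_fin, mul_div_cancel₀]
  positivity

/-- A random arrangement of an interval is sorted with the average number of comparisons. -/
theorem sum_quicksort_of_interval (T : ∀ n, ClassTree n) (R : Arrangement) {ys : List ℕ} {o k : ℕ}
    (hys : ys.Nodup) (hA : ys.toFinset = Finset.Ioc o (o + k)) :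
    ∑ zs ∈ ys.permutations.toFinset, ((quicksort T R zs).2 : ℝ) =
      k.factorial * avgComparisons T R k := by
  have hlen : ys.length = k := by
    rw [← List.toFinset_card_of_nodup hys, hA]; simp
  have hmono : StrictMono fun x => x + o := fun x y h => by simpa using h
  rw [avgComparisons_eq, ← sum_eq_sum_permutations hys
    (m := fun σ : Equiv.Perm (Fin k) => (input σ).map fun x => x + o)]
  · simp only [quicksort_map_snd T R hmono]
  · exact (List.map_injective_iff.2 hmono.injective).comp (input_injective k)
  · intro σ
    refine List.perm_of_nodup_nodup_toFinset_eq ((nodup_input σ).map hmono.injective) hys ?_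
    rw [hA]
    ext x
    have hx : ∀ y, y ∈ input σ ↔ y ∈ Finset.Icc 1 k := fun y => by
      rw [← toFinset_input σ, List.mem_toFinset]
    simp only [List.mem_toFinset, List.mem_map, hx, Finset.mem_Icc, Finset.mem_Ioc]
    constructor
    · rintro ⟨y, hy, rfl⟩; omega
    · intro h; exact ⟨x - o, by omega, by omega⟩
  · rw [Fintype.card_perm, Fintype.card_fin, hlen]

theorem group_eq_Ioc {n p q : ℕ} (hp : 1 ≤ p) (hpq : p < q) (hq : q ≤ n) (c : Cls) :
    ∃ o, group n p q c = Finset.Ioc o (o + groupSize n p q c) := by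
  refine ⟨match c with | .small => 0 | .medium => p | .large => q, ?_⟩
  ext x
  cases c <;> simp only [group, groupSize, Finset.mem_Ico, Finset.mem_Ioo, Finset.mem_Ioc] <;>
    omega

section subarray

variable {n : ℕ} (T : ∀ n, ClassTree n) (R : Arrangement)

theorem classPath_input (hn : 2 ≤ n) (σ : Equiv.Perm (Fin n)) :
    classPath T (input σ) = (T n).tree.trace (inputCls σ) := by
  rw [classPath, ← path_input σ hn]
  congr 2 <;> rw [length_input]

theorem nodup_subarray (hn : 2 ≤ n) (σ : Equiv.Perm (Fin n)) (c : Cls) :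
    (subarray T R (input σ) c).Nodup := by
  have hnd : (R.arrange (classPath T (input σ)) c).Nodup := by
    rw [(R.perm _ c).nodup_iff]
    refine List.Nodup.sublist (List.filter_sublist.map _) ?_
    rw [classPath_input T hn, ← Multiset.coe_nodup, DTree.map_idx_trace _ (T n).covers]
    exact Finset.nodup _
  refine hnd.map_on fun i hi j hj h => ?_
  have hi := mem_arrange_classPath T R hi
  have hj := mem_arrange_classPath T R hj
  rw [length_input] at hi hj
  have e1 := elt_input σ ⟨i - 1, by omega⟩
  have e2 := elt_input σ ⟨j - 1, by omega⟩
  simp only [Nat.sub_add_cancel hi.1, Nat.sub_add_cancel hj.1] at e1 e2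
  have := σ.injective (Fin.ext (show (σ ⟨i - 1, by omega⟩ : ℕ) = σ ⟨j - 1, by omega⟩ by omega))
  rw [Fin.mk.injEq] at this
  omega

theorem toFinset_subarray (hn : 2 ≤ n) (σ : Equiv.Perm (Fin n)) (c : Cls) :
    (subarray T R (input σ) c).toFinset =
      group n (pivotP (input σ)) (pivotQ (input σ)) c := by
  obtain ⟨h1, h2, h3⟩ := pivot_bounds σ hn
  refine Finset.eq_of_subset_of_card_le (fun x hx => ?_) ?_
  · obtain ⟨i, hi, rfl⟩ := List.mem_map.1 (List.mem_toFinset.1 hx)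
    obtain ⟨v, hv, hvc, rfl⟩ := (mem_arrange R).1 hi
    have hidx := Finset.mem_Icc.1 (DTree.idx_mem_of_mem_path _ (T _).covers hv)
    rw [length_input] at hidx
    rw [classPath_input T hn] at hv
    have hcls := DTree.cls_of_mem_trace _ hv
    have ho := optCls_input σ hn ⟨v.idx - 1, by omega⟩
    have he := elt_input σ ⟨v.idx - 1, by omega⟩
    simp only [show v.idx - 1 + 1 = v.idx by omega] at ho he
    rw [if_neg (by omega), optCls_eq_some, ← he] at ho
    rw [mem_group h2 h3]
    refine ⟨?_, ho.1, ho.2.1, by rw [ho.2.2, ← hcls, hvc]⟩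
    rw [he, Finset.mem_Icc]
    omega
  · rw [List.toFinset_card_of_nodup (nodup_subarray T R hn σ c), card_group,
      ← count_word_input hn σ (T n), ← DTree.map_cls_trace, subarray, List.length_map,
      (R.perm _ c).length_eq, List.length_map, ← List.countP_eq_length_filter,
      classPath_input T hn, List.count, List.countP_map]
    refine (List.countP_congr fun v _ => ?_).le
    simp

/-- Permuting the values of one class changes neither the pivots nor the path; it permutes the
subarray of that class in the same way. -/
theorem map_ofSubtype_mem {p q : ℕ} (hn : 2 ≤ n) (hpq : p < q) (hq : q ≤ n) {c : Cls}
    (τ : Equiv.Perm {x // x ∈ group n p q c}) {xs : List ℕ}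
    (hxs : xs ∈ (List.range' 1 n).permutations.toFinset.filter
      fun xs => (pivotP xs, pivotQ xs) = (p, q)) :
    xs.map (Equiv.Perm.ofSubtype τ) ∈ (List.range' 1 n).permutations.toFinset.filter
        (fun xs => (pivotP xs, pivotQ xs) = (p, q)) ∧
      subarray T R (xs.map (Equiv.Perm.ofSubtype τ)) c =
        (subarray T R xs c).map (Equiv.Perm.ofSubtype τ) := by
  set g : ℕ → ℕ := ⇑(Equiv.Perm.ofSubtype τ) with hg
  have hmem : ∀ x, x ∈ group n p q c → g x ∈ group n p q c := fun x hx => by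
    rw [hg, Equiv.Perm.ofSubtype_apply_of_mem τ hx]; exact (τ _).2
  have hnot : ∀ x, x ∉ group n p q c → g x = x := fun x hx =>
    Equiv.Perm.ofSubtype_apply_of_not_mem τ hx
  have hgp : g p = p := hnot p fun h => ((mem_group hpq hq).1 h).2.1 rfl
  have hgq : g q = q := hnot q fun h => ((mem_group hpq hq).1 h).2.2.1 rfl
  rw [Finset.mem_filter, List.mem_toFinset, List.mem_permutations, Prod.mk.injEq] at hxs ⊢
  obtain ⟨hperm, hP, hQ⟩ := hxs
  have hlen : xs.length = n := by rw [hperm.length_eq, List.length_range']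
  have e1 := elt_map g (xs := xs) (i := 1) le_rfl (by omega)
  have en := elt_map g (xs := xs) (i := n) (by omega) (by omega)
  have hP' : pivotP (xs.map g) = p ∧ pivotQ (xs.map g) = q := by
    rw [pivotP, pivotQ, List.length_map, hlen, e1, en]
    rw [pivotP, hlen] at hP
    rw [pivotQ, hlen] at hQ
    rcases le_total (elt xs 1) (elt xs n) with h | h
    · rw [min_eq_left h] at hP
      rw [max_eq_right h] at hQ
      rw [hP, hQ, hgp, hgq, min_eq_left hpq.le, max_eq_right hpq.le]
      exact ⟨rfl, rfl⟩
    · rw [min_eq_right h] at hP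
      rw [max_eq_left h] at hQ
      rw [hP, hQ, hgp, hgq, min_eq_right hpq.le, max_eq_left hpq.le]
      exact ⟨rfl, rfl⟩
  refine ⟨⟨?_, hP'⟩, ?_⟩
  · have hnd : xs.Nodup := hperm.nodup_iff.2 List.nodup_range'
    have hx : ∀ x, x ∈ xs ↔ x ∈ Finset.Icc 1 n := fun x => by
      rw [hperm.mem_iff, List.mem_range'_1, Finset.mem_Icc]; omega
    refine List.Perm.trans ?_ hperm
    refine List.perm_of_nodup_nodup_toFinset_eq (hnd.map (Equiv.injective _)) hnd ?_
    refine Finset.eq_of_subset_of_card_le (fun y hy => ?_) ?_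
    · obtain ⟨x, hxx, rfl⟩ := List.mem_map.1 (List.mem_toFinset.1 hy)
      rw [List.mem_toFinset, hx]
      rw [hx] at hxx
      by_cases h : x ∈ group n p q c
      · exact ((mem_group hpq hq).1 (hmem x h)).1
      · rwa [hnot x h]
    · rw [List.toFinset_card_of_nodup hnd,
        List.toFinset_card_of_nodup (hnd.map (Equiv.injective _)), List.length_map]
  · refine subarray_map T R (classPath_map T ?_ ?_ fun x l => ?_) c
    · rw [hP'.1, hP, hgp]
    · rw [hP'.2, hQ, hgq]
    · rw [hP, hQ, hgp, hgq]
      by_cases h : x ∈ group n p q c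
      · obtain ⟨-, h1, h2, h3⟩ := (mem_group hpq hq).1 h
        obtain ⟨-, h1', h2', h3'⟩ := (mem_group hpq hq).1 (hmem x h)
        rw [classify_fst l hpq h1 h2, classify_fst l hpq h1' h2', h3, h3']
      · rw [hnot x h]

/-- Given the pivots, the subarrays are in random order. -/
theorem sum_quicksort_subarray_of_pivots {p q : ℕ} (hn : 2 ≤ n) (hp : 1 ≤ p) (hpq : p < q)
    (hq : q ≤ n) (c : Cls) :
    ∑ xs ∈ (List.range' 1 n).permutations.toFinset with (pivotP xs, pivotQ xs) = (p, q),
        ((quicksort T R (subarray T R xs c)).2 : ℝ) =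
      ∑ xs ∈ (List.range' 1 n).permutations.toFinset with (pivotP xs, pivotQ xs) = (p, q),
        avgComparisons T R (groupSize n p q c) := by
  -- Every permutation `τ` of the values of class `c` acts on the inputs with the given pivots and
  -- commutes with taking the subarray; the sum over the inputs is averaged over all `τ`.
  set Ω := (List.range' 1 n).permutations.toFinset.filter
    fun xs => (pivotP xs, pivotQ xs) = (p, q) with hΩ
  set k := groupSize n p q c
  have hinner : ∀ xs ∈ Ω, ∑ τ : Equiv.Perm {x // x ∈ group n p q c},
      ((quicksort T R ((subarray T R xs c).map (Equiv.Perm.ofSubtype τ))).2 : ℝ) =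
        k.factorial * avgComparisons T R k := by
    intro xs hxs
    obtain ⟨hxs, hpiv⟩ := Finset.mem_filter.1 hxs
    obtain ⟨σ, rfl⟩ := mem_permutations_range'.1 hxs
    rw [Prod.mk.injEq] at hpiv
    have hset := toFinset_subarray T R hn σ c
    have hnd := nodup_subarray T R hn σ c
    rw [hpiv.1, hpiv.2] at hset
    obtain ⟨o, ho⟩ := group_eq_Ioc hp hpq hq c
    rw [sum_map_ofSubtype hnd hset fun zs => ((quicksort T R zs).2 : ℝ)]
    exact sum_quicksort_of_interval T R hnd (hset.trans ho)
  have houter : ∀ τ : Equiv.Perm {x // x ∈ group n p q c},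
      ∑ xs ∈ Ω, ((quicksort T R ((subarray T R xs c).map (Equiv.Perm.ofSubtype τ))).2 : ℝ) =
        ∑ xs ∈ Ω, ((quicksort T R (subarray T R xs c)).2 : ℝ) := by
    intro τ
    refine Finset.sum_nbij' (List.map (Equiv.Perm.ofSubtype τ))
      (List.map (Equiv.Perm.ofSubtype τ⁻¹)) ?_ ?_ ?_ ?_ ?_
    · exact fun xs hxs => (map_ofSubtype_mem T R hn hpq hq τ hxs).1
    · exact fun xs hxs => (map_ofSubtype_mem T R hn hpq hq τ⁻¹ hxs).1
    · intro xs _; simp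
    · intro xs _; simp
    · intro xs hxs; rw [(map_ofSubtype_mem T R hn hpq hq τ hxs).2]
  have hswap := Finset.sum_comm (s := (Finset.univ : Finset (Equiv.Perm {x // x ∈ group n p q c})))
    (t := Ω) (f := fun τ xs =>
      ((quicksort T R ((subarray T R xs c).map (Equiv.Perm.ofSubtype τ))).2 : ℝ))
  rw [Finset.sum_congr rfl hinner, Finset.sum_congr rfl fun τ _ => houter τ, Finset.sum_const,
    Finset.card_univ, Fintype.card_perm, Fintype.card_coe, card_group, nsmul_eq_mul,
    ← Finset.mul_sum] at hswap
  exact mul_left_cancel₀ (by positivity) hswap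

theorem expect_quicksort_subarray (hn : 2 ≤ n) (c : Cls) :
    𝔼 σ : Equiv.Perm (Fin n), ((quicksort T R (subarray T R (input σ) c)).2 : ℝ) =
      𝔼 σ : Equiv.Perm (Fin n),
        avgComparisons T R (groupSize n (pivotP (input σ)) (pivotQ (input σ)) c) := by
  rw [Finset.expect_eq_sum_div_card, Finset.expect_eq_sum_div_card,
    sum_input fun xs => ((quicksort T R (subarray T R xs c)).2 : ℝ),
    sum_input fun xs => avgComparisons T R (groupSize n (pivotP xs) (pivotQ xs) c)]
  congr 1
  have hmaps : ∀ xs ∈ (List.range' 1 n).permutations.toFinset, (pivotP xs, pivotQ xs) ∈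
      (List.range' 1 n).permutations.toFinset.image fun xs => (pivotP xs, pivotQ xs) :=
    fun xs hxs => Finset.mem_image_of_mem _ hxs
  rw [← Finset.sum_fiberwise_of_maps_to hmaps, ← Finset.sum_fiberwise_of_maps_to hmaps]
  refine Finset.sum_congr rfl fun pq hpq => ?_
  obtain ⟨xs, hxs, rfl⟩ := Finset.mem_image.1 hpq
  obtain ⟨σ, rfl⟩ := mem_permutations_range'.1 hxs
  obtain ⟨h1, h2, h3⟩ := pivot_bounds σ hn
  rw [sum_quicksort_subarray_of_pivots T R hn h1 h2 h3]
  refine Finset.sum_congr rfl fun ys hys => ?_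
  have := (Finset.mem_filter.1 hys).2
  rw [Prod.mk.injEq] at this
  rw [this.1, this.2]

end subarray

theorem avgComparisons_of_le (T : ∀ n, ClassTree n) (R : Arrangement) {n : ℕ} (hn : n ≤ 1) :
    avgComparisons T R n = 0 := by
  refine Finset.expect_eq_zero fun σ _ => ?_
  rw [quicksort_snd_of_le T R (by rwa [length_input]), Nat.cast_zero]

theorem avgComparisons_eq_pairMean {T : ∀ n, ClassTree n} (R : Arrangement)
    (hT : ∀ n, (T n).Implements ruleL) {n : ℕ} (hn : 2 ≤ n) :
    avgComparisons T R n = n - 1 + pairMean n (fun s l => ((n - 2 - s - l : ℕ) : ℝ)) +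
      mean (n - 2) (fun w => (stepSum costL w : ℝ)) +
      (pairMean n (fun s _ => avgComparisons T R s) +
        pairMean n (fun s l => avgComparisons T R (n - 2 - s - l)) +
        pairMean n (fun _ l => avgComparisons T R l)) := by
  have hpath : ∀ σ : Equiv.Perm (Fin n), classPath T (input σ) =
      (T n).tree.path (pivotP (input σ)) (pivotQ (input σ)) (elt (input σ)) := fun σ => by
    rw [classPath_input T hn, path_input σ hn]
  have hone : 𝔼 _σ : Equiv.Perm (Fin n), ((n : ℝ) - 1) = n - 1 :=
    Finset.expect_const Finset.univ_nonempty _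
  have hmed : ∀ σ : Equiv.Perm (Fin n), groupSize n (pivotP (input σ)) (pivotQ (input σ)) .medium =
      n - 2 - (pivotP (input σ) - 1) - (n - pivotQ (input σ)) := fun σ => by
    have := pivot_bounds σ hn
    simp only [groupSize]
    omega
  have e := fun c => expect_quicksort_subarray (n := n) T R hn c
  have es := e .small
  have em := e .medium
  have el := e .large
  simp only [hmed] at em
  simp only [groupSize] at es el
  rw [pairMean_eq_expect hn fun s _ => avgComparisons T R s,
    pairMean_eq_expect hn fun s l => avgComparisons T R (n - 2 - s - l),
    pairMean_eq_expect hn fun _ l => avgComparisons T R l,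
    pairMean_eq_expect hn fun s l => ((n - 2 - s - l : ℕ) : ℝ), ← es, ← em, ← el,
    ← expect_additionalCost hn (hT n), ← hone, avgComparisons]
  simp only [← Finset.expect_add_distrib]
  refine Finset.expect_congr rfl fun σ _ => ?_
  rw [quicksort_snd T R (by rw [length_input]; omega), sum_cls, hpath,
    DTree.length_path _ (T n).covers, path_input σ hn, DTree.map_cls_trace,
    count_word_input hn, hmed, Nat.card_Icc]
  push_cast [show n - 1 + 1 - 2 = n - 2 by omega, hn]
  ring

/-! ### The additional cost terms -/

theorem choose_two_succ (m : ℕ) : (((m + 1).choose 2 : ℕ) : ℝ) = m * (m + 1) / 2 := by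
  rw [Nat.cast_choose_two]; push_cast; ring

/-- The expected cost is a sum over the steps; before step `t + 1` all pairs of numbers of small
and large elements are equally likely. -/
theorem mean_stepSum_eq_sum_pairMean {k : ℕ → ℕ → Cls → ℕ} (hk : ∀ x y, k x y .medium = 0)
    (N : ℕ) : mean N (fun w => (stepSum k w : ℝ)) = ∑ t ∈ Finset.range N,
      pairMean (t + 2) fun x y =>
        ((x + 1) * k x y .small + (y + 1) * k x y .large : ℝ) / (t + 3) := by
  rw [mean_stepSum]
  refine Finset.sum_congr rfl fun t _ => ?_
  rw [← mean_counts]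
  refine mean_congr fun w _ => ?_
  rw [sum_cls, hk, Nat.cast_zero]
  ring

theorem costL_medium (x y : ℕ) : costL x y .medium = 0 := by simp [costL]

theorem costO_medium (x y : ℕ) : costO x y .medium = 0 := by simp [costO]

/-- Removing both ends of a diagonal and shifting lowers each minimum by one. -/
theorem sum_min_add_two (r : ℕ) : ∑ x ∈ Finset.range (r + 3), min x (r + 2 - x) =
    ∑ x ∈ Finset.range (r + 1), min x (r - x) + (r + 1) := by
  rw [Finset.sum_range_succ, Finset.sum_range_succ']
  have : ∀ x ∈ Finset.range (r + 1), min (x + 1) (r + 2 - (x + 1)) = min x (r - x) + 1 := by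
    intro x hx
    rw [Finset.mem_range] at hx
    omega
  rw [Finset.sum_congr rfl this, Finset.sum_add_distrib]
  simp

theorem abs_sum_min_sub_le (r : ℕ) :
    |((∑ x ∈ Finset.range (r + 1), min x (r - x) : ℕ) : ℝ) - (r : ℝ) ^ 2 / 4| ≤ 1 / 4 := by
  induction r using Nat.twoStepInduction with
  | zero => norm_num
  | one => norm_num [Finset.sum_range_succ]
  | more r ih _ =>
    rw [sum_min_add_two]
    convert ih using 2
    push_cast
    ring

theorem abs_sum_sum_min_sub_le (m : ℕ) :
    |∑ s ∈ Finset.range m, ∑ l ∈ Finset.range (m - s), ((min s l : ℕ) : ℝ) -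
      (m - 1) * m * (2 * m - 1) / 24| ≤ m / 4 := by
  have hsq : ∀ m : ℕ, ∑ r ∈ Finset.range m, (r : ℝ) ^ 2 / 4 =
      ((m : ℝ) - 1) * m * (2 * m - 1) / 24 := by
    intro m
    induction m with
    | zero => simp
    | succ m ih => rw [Finset.sum_range_succ, ih]; push_cast; ring
  rw [← Finset.sum_range_diag_flip m fun s l => ((min s l : ℕ) : ℝ), ← hsq,
    ← Finset.sum_sub_distrib]
  refine (Finset.abs_sum_le_sum_abs _ _).trans ?_
  refine (Finset.sum_le_sum (g := fun _ => (1 / 4 : ℝ)) fun r _ => ?_).trans ?_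
  · have := abs_sum_min_sub_le r
    push_cast at this ⊢
    exact this
  · simp [div_eq_mul_inv]

theorem sum_sum_one (m : ℕ) :
    ∑ s ∈ Finset.range m, ∑ _l ∈ Finset.range (m - s), (1 : ℝ) = m * (m + 1) / 2 := by
  rw [← Finset.sum_range_diag_flip m fun _ _ => (1 : ℝ)]
  induction m with
  | zero => simp
  | succ m ih => rw [Finset.sum_range_succ, ih]; simp; ring

/-- Each step of strategy `L` causes one additional comparison with probability about `1 / 6`. -/
theorem abs_pairMean_costL_sub_le (t : ℕ) : |pairMean (t + 2) (fun x y =>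
    ((x + 1) * costL x y .small + (y + 1) * costL x y .large : ℝ) / (t + 3)) - 1 / 6| ≤
      3 * ((t : ℝ) + 1)⁻¹ := by
  have hmin : ∀ x y : ℕ, ((x + 1) * costL x y .small + (y + 1) * costL x y .large : ℝ) / (t + 3) =
      (((min x y : ℕ) : ℝ) + 1) / (t + 3) := by
    intro x y
    rcases le_or_gt x y with h | h
    · simp [costL, h, not_lt.2 h]
    · simp [costL, h, not_le.2 h, h.le]
  have hm := abs_sum_sum_min_sub_le (t + 1)
  simp only [hmin, pairMean, show t + 2 - 1 = t + 1 from rfl, choose_two_succ, ← Finset.sum_div,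
    Finset.sum_add_distrib, sum_sum_one]
  set S := ∑ s ∈ Finset.range (t + 1), ∑ l ∈ Finset.range (t + 1 - s), ((min s l : ℕ) : ℝ)
  have ht : (0 : ℝ) ≤ t := t.cast_nonneg
  push_cast at hm ⊢
  have e : (1 / (((t : ℝ) + 1) * (t + 1 + 1) / 2)) *
      ((S + (t + 1) * (t + 1 + 1) / 2) / (t + 3)) - 1 / 6 =
      (2 * (S - (t + 1 - 1) * (t + 1) * (2 * (t + 1) - 1) / 24) + (t + 1) * (t + 4) / 4) /
        ((t + 1) * (t + 2) * (t + 3)) := by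
    field_simp
    ring
  rw [e, abs_div, abs_of_pos (by positivity : (0 : ℝ) < (t + 1) * (t + 2) * (t + 3)),
    div_le_iff₀ (by positivity)]
  have e2 : 3 * ((t : ℝ) + 1)⁻¹ * ((t + 1) * (t + 2) * (t + 3)) = 3 * ((t + 2) * (t + 3)) := by
    field_simp
  rw [e2]
  rw [abs_le] at hm ⊢
  constructor <;> nlinarith

theorem sum_range_inv_eq_harmonic (n : ℕ) :
    ∑ t ∈ Finset.range n, ((t : ℝ) + 1)⁻¹ = harmonic n := by
  simp [harmonic]

theorem harmonic_mono_real {m n : ℕ} (h : m ≤ n) : ((harmonic m : ℚ) : ℝ) ≤ harmonic n := by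
  rw [← sum_range_inv_eq_harmonic, ← sum_range_inv_eq_harmonic]
  exact Finset.sum_le_sum_of_subset_of_nonneg (Finset.range_subset_range.2 h)
    fun _ _ _ => by positivity

theorem abs_mean_costL_sub_le (N : ℕ) :
    |mean N (fun w => (stepSum costL w : ℝ)) - N / 6| ≤ 3 * harmonic N := by
  have : (N : ℝ) / 6 = ∑ _t ∈ Finset.range N, (1 / 6 : ℝ) := by
    simp [div_eq_mul_inv]
  rw [mean_stepSum_eq_sum_pairMean costL_medium, this, ← Finset.sum_sub_distrib,
    ← sum_range_inv_eq_harmonic, Finset.mul_sum]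
  exact (Finset.abs_sum_le_sum_abs _ _).trans
    (Finset.sum_le_sum fun t _ => abs_pairMean_costL_sub_le t)

theorem abs_pairMean_le {n : ℕ} {φ ψ : ℕ → ℕ → ℝ} (h : ∀ x y, x + y + 2 ≤ n → |φ x y| ≤ ψ x y) :
    |pairMean n φ| ≤ pairMean n ψ := by
  rw [pairMean, pairMean, abs_mul, abs_of_nonneg (by positivity)]
  refine mul_le_mul_of_nonneg_left ?_ (by positivity)
  refine (Finset.abs_sum_le_sum_abs _ _).trans (Finset.sum_le_sum fun s hs =>
    (Finset.abs_sum_le_sum_abs _ _).trans (Finset.sum_le_sum fun l hl => h s l ?_))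
  rw [Finset.mem_range] at hs hl
  omega

theorem pairMean_sub (n : ℕ) (φ ψ : ℕ → ℕ → ℝ) :
    pairMean n φ - pairMean n ψ = pairMean n fun x y => φ x y - ψ x y := by
  simp [pairMean, ← mul_sub, Finset.sum_sub_distrib]

/-- Each row contains at most two pairs next to the diagonal. -/
theorem sum_diagonals_le (m s : ℕ) :
    ∑ l ∈ Finset.range m, (if s = l ∨ s = l + 1 then (1 : ℝ) else 0) ≤ 2 := by
  rw [← Finset.sum_filter, Finset.sum_const, nsmul_one]
  have : ((Finset.range m).filter fun l => s = l ∨ s = l + 1) ⊆ {s, s - 1} := by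
    intro l hl
    simp only [Finset.mem_filter, Finset.mem_insert, Finset.mem_singleton] at hl ⊢
    omega
  exact_mod_cast (Finset.card_le_card this).trans Finset.card_le_two

/-- The costs of a step of `L` and of a step of `O` run backwards differ only next to the diagonal,
which is hit at time `t` with probability `O(1 / t)`. -/
theorem abs_pairMean_costL_sub_costO_le (t : ℕ) : |pairMean (t + 2) (fun x y =>
    ((x + 1) * costL x y .small + (y + 1) * costL x y .large : ℝ) / (t + 3)) -
      pairMean (t + 2) (fun x y =>
    ((x + 1) * costO x y .small + (y + 1) * costO x y .large : ℝ) / (t + 3))| ≤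
      4 * ((t : ℝ) + 1)⁻¹ := by
  rw [pairMean_sub]
  refine (abs_pairMean_le (ψ := fun x y => if x = y ∨ x = y + 1 then (1 : ℝ) else 0)
    fun x y hxy => ?_).trans ?_
  · have hx : (x : ℝ) + y ≤ t := by exact_mod_cast (by omega : x + y ≤ t)
    have hx0 : (0 : ℝ) ≤ x := x.cast_nonneg
    have hy0 : (0 : ℝ) ≤ y := y.cast_nonneg
    have ht : (0 : ℝ) < t + 3 := by linarith
    rw [← sub_div, abs_div, abs_of_pos ht, div_le_iff₀ ht]
    rcases lt_trichotomy x y with h | h | h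
    · have h1 : ¬ y + 1 < x := by omega
      have h2 : ¬ x = y + 1 := by omega
      simp [costL, costO, h, h.le, h.not_gt, h1, h.ne, h2]
    · subst h
      simp only [costL, costO]
      simp
      rw [abs_of_nonneg (by linarith)]
      linarith
    · rcases eq_or_ne x (y + 1) with h' | h'
      · subst h'
        simp only [costL, costO]
        simp
        push_cast at hx
        rw [abs_of_nonneg (by linarith)]
        linarith
      · have h1 : y + 1 < x := by omega
        simp [costL, costO, h, h.not_ge, h.not_gt, h1, h.ne', h']
  · rw [pairMean, show t + 2 - 1 = t + 1 from rfl, choose_two_succ]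
    have := Finset.sum_le_sum (s := Finset.range (t + 1))
      fun s _ => sum_diagonals_le (t + 1 - s) s
    rw [Finset.sum_const, Finset.card_range, nsmul_eq_mul] at this
    refine (mul_le_mul_of_nonneg_left this (by positivity)).trans ?_
    rw [← div_eq_mul_inv, le_div_iff₀ (by positivity)]
    push_cast
    field_simp
    nlinarith

theorem abs_mean_costL_sub_mean_costO_le (N : ℕ) :
    |mean N (fun w => (stepSum costL w : ℝ)) - mean N (fun w => (stepSum costO w : ℝ))| ≤
      4 * harmonic N := by
  rw [mean_stepSum_eq_sum_pairMean costL_medium, mean_stepSum_eq_sum_pairMean costO_medium,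
    ← Finset.sum_sub_distrib, ← sum_range_inv_eq_harmonic, Finset.mul_sum]
  exact (Finset.abs_sum_le_sum_abs _ _).trans
    (Finset.sum_le_sum fun t _ => abs_pairMean_costL_sub_costO_le t)

theorem exists_abs_ACT_sub_le : ∃ C : ℝ, ∀ n : ℕ, 2 ≤ n →
    ∀ (tL : ClassTree n) (tO : ℕ → ℕ → ClassTree n), tL.Implements ruleL →
      (∀ s l : ℕ, s + l ≤ n - 2 → (tO s l).Implements (ruleO s l)) →
        |ACT n (fun _ _ => tL) - ACT n tO| ≤ C * Real.log n := by
  have hlog2 : 0 < Real.log 2 := Real.log_pos one_lt_two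
  -- `H_n ≤ 1 + log n`, and `1 ≤ log n / log 2` absorbs the constant term.
  refine ⟨4 * (1 / Real.log 2 + 1), fun n hn tL tO hL hO => ?_⟩
  rw [ACT_eq_mean_costL hn hL, ACT_eq_mean_costO hn hO]
  have h1 := abs_mean_costL_sub_mean_costO_le (n - 2)
  have h2 := harmonic_mono_real (Nat.sub_le n 2)
  have h3 := harmonic_le_one_add_log n
  have h4 : Real.log 2 ≤ Real.log n := Real.log_le_log two_pos (by exact_mod_cast hn)
  have h5 : 1 ≤ 1 / Real.log 2 * Real.log n := by
    rw [div_mul_eq_mul_div, one_mul, one_le_div hlog2]; exact h4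
  linarith

/-! ### Solution of the recurrence -/

/-- The triangular sum `∑ (m - k) f k` in the recurrence for subarrays of length `m + 1`. -/
def triSum (m : ℕ) (f : ℕ → ℝ) : ℝ := ∑ k ∈ Finset.range m, ((m - k : ℕ) : ℝ) * f k

theorem triSum_succ (m : ℕ) (f : ℕ → ℝ) :
    triSum (m + 1) f = triSum m f + ∑ k ∈ Finset.range (m + 1), f k := by
  have : triSum m f = ∑ k ∈ Finset.range (m + 1), ((m - k : ℕ) : ℝ) * f k := by
    rw [Finset.sum_range_succ]; simp [triSum]
  rw [this, triSum, ← Finset.sum_add_distrib]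
  refine Finset.sum_congr rfl fun k hk => ?_
  rw [Finset.mem_range] at hk
  rw [show m + 1 - k = (m - k) + 1 by omega]
  push_cast
  ring

theorem triSum_sub (m : ℕ) (f g : ℕ → ℝ) :
    triSum m (fun k => f k - g k) = triSum m f - triSum m g := by
  simp [triSum, mul_sub, Finset.sum_sub_distrib]

theorem triSum_const_mul (m : ℕ) (a : ℝ) (f : ℕ → ℝ) :
    triSum m (fun k => a * f k) = a * triSum m f := by
  rw [triSum, triSum, Finset.mul_sum]
  exact Finset.sum_congr rfl fun k _ => by ring

theorem triSum_eq_sum_sum (m : ℕ) (f : ℕ → ℝ) :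
    triSum m f = ∑ s ∈ Finset.range m, ∑ _l ∈ Finset.range (m - s), f s := by
  simp [triSum]

theorem pairMean_fst (m : ℕ) (f : ℕ → ℝ) :
    pairMean (m + 1) (fun s _ => f s) = 1 / ((m : ℝ) * (m + 1) / 2) * triSum m f := by
  rw [pairMean, choose_two_succ, triSum_eq_sum_sum, Nat.add_sub_cancel]

theorem pairMean_snd (m : ℕ) (f : ℕ → ℝ) :
    pairMean (m + 1) (fun _ l => f l) = 1 / ((m : ℝ) * (m + 1) / 2) * triSum m f := by
  rw [pairMean, choose_two_succ, triSum_eq_sum_sum, Nat.add_sub_cancel]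
  congr 1
  refine Finset.sum_comm' fun s l => ?_
  simp only [Finset.mem_range]
  omega

theorem pairMean_rest (m : ℕ) (f : ℕ → ℝ) :
    pairMean (m + 1) (fun s l => f (m + 1 - 2 - s - l)) =
      1 / ((m : ℝ) * (m + 1) / 2) * triSum m f := by
  rw [← pairMean_snd, pairMean, pairMean, Nat.add_sub_cancel]
  congr 1
  refine Finset.sum_congr rfl fun s _ => ?_
  rw [← Finset.sum_range_reflect]
  refine Finset.sum_congr rfl fun l hl => ?_
  rw [Finset.mem_range] at hl
  congr 1
  omega

theorem triSum_one (m : ℕ) : triSum m (fun _ => 1) = m * (m + 1) / 2 := by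
  induction m with
  | zero => simp [triSum]
  | succ m ih => rw [triSum_succ, ih]; simp; ring

theorem triSum_id (m : ℕ) : triSum m (fun k => (k : ℝ)) = (m - 1) * m * (m + 1) / 6 := by
  have h : ∀ m : ℕ, ∑ k ∈ Finset.range m, (k : ℝ) = (m - 1 : ℝ) * m / 2 := by
    intro m
    induction m with
    | zero => simp
    | succ m ih => rw [Finset.sum_range_succ, ih]; push_cast; ring
  induction m with
  | zero => simp [triSum]
  | succ m ih => rw [triSum_succ, ih, h]; push_cast; ring

theorem cast_harmonic_succ (m : ℕ) :
    ((harmonic (m + 1) : ℚ) : ℝ) = harmonic m + ((m : ℝ) + 1)⁻¹ := by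
  rw [harmonic_succ]; push_cast; rfl

theorem triSum_harmonic (m : ℕ) : triSum m (fun k => (harmonic k : ℝ)) =
    m * (m + 1) / 2 * (harmonic (m + 1) - 3 / 2) := by
  have h : ∀ m : ℕ, ∑ k ∈ Finset.range m, (harmonic k : ℝ) = m * (harmonic m : ℝ) - m := by
    intro m
    induction m with
    | zero => simp
    | succ m ih =>
      rw [Finset.sum_range_succ, ih, cast_harmonic_succ]
      push_cast
      field_simp
      ring
  induction m with
  | zero => simp [triSum]
  | succ m ih =>
    rw [triSum_succ, ih, h, cast_harmonic_succ (m + 1)]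
    push_cast
    field_simp
    ring

theorem triSum_mul_harmonic (m : ℕ) :
    triSum m (fun k => ((k : ℝ) + 1) * (harmonic (k + 1) : ℝ)) =
      m * (m + 1) * (m + 2) / 6 * (harmonic (m + 2) - 5 / 6) := by
  have h : ∀ m : ℕ, ∑ k ∈ Finset.range m, ((k : ℝ) + 1) * (harmonic (k + 1) : ℝ) =
      m * (m + 1) / 2 * (harmonic (m + 1) - 1 / 2) := by
    intro m
    induction m with
    | zero => simp
    | succ m ih =>
      rw [Finset.sum_range_succ, ih, cast_harmonic_succ (m + 1)]
      push_cast
      field_simp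
      ring
  induction m with
  | zero => simp [triSum]
  | succ m ih =>
    rw [triSum_succ, ih, h, cast_harmonic_succ (m + 2)]
    push_cast
    field_simp
    ring

/-- A dual pivot quicksort recurrence with toll `b n = O(log n)` has a solution of size `O(n)`. -/
theorem abs_le_of_recurrence {D b : ℕ → ℝ} {K : ℝ} (hK : 0 ≤ K)
    (h0 : |D 0| ≤ K) (h1 : |D 1| ≤ K)
    (hD : ∀ m : ℕ, 1 ≤ m → D (m + 1) = b (m + 1) + 6 / ((m : ℝ) * (m + 1)) * triSum m D)
    (hb : ∀ n : ℕ, 2 ≤ n → |b n| ≤ K * harmonic n) (n : ℕ) : |D n| ≤ 3 * K * (n + 1) := by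
  -- The supersolution: `n + 1` solves the homogeneous equation, and `-H_n / 2 - 9 / 8`
  -- produces the toll `H_n`.
  let G : ℕ → ℝ := fun n => K * (3 * ((n : ℝ) + 1) - 1 / 2 * harmonic n - 9 / 8)
  have hG : ∀ m : ℕ, 1 ≤ m →
      G (m + 1) = K * harmonic (m + 1) + 6 / ((m : ℝ) * (m + 1)) * triSum m G := by
    intro m hm
    have hm0 : (m : ℝ) ≠ 0 := by positivity
    have : triSum m G = K * (3 * triSum m (fun k => (k : ℝ)) -
        1 / 2 * triSum m (fun k => (harmonic k : ℝ)) + 15 / 8 * triSum m fun _ => 1) := by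
      simp only [triSum, Finset.mul_sum, ← Finset.sum_sub_distrib, ← Finset.sum_add_distrib, G]
      exact Finset.sum_congr rfl fun k _ => by ring
    rw [this, triSum_id, triSum_harmonic, triSum_one]
    simp only [G]
    push_cast
    field_simp
    ring
  have key : ∀ n, |D n| ≤ G n := by
    intro n
    induction n using Nat.strong_induction_on with
    | _ n ih =>
      rcases (by omega : n = 0 ∨ n = 1 ∨ 2 ≤ n) with rfl | rfl | hn
      · refine h0.trans ?_
        simp only [G, harmonic_zero]
        norm_num
        linarith
      · refine h1.trans ?_
        simp only [G]
        rw [show (harmonic 1 : ℚ) = 1 by simp [harmonic]]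
        norm_num
        linarith
      · obtain ⟨m, rfl⟩ : ∃ m, n = m + 1 := ⟨n - 1, by omega⟩
        have htri : |triSum m D| ≤ triSum m G := by
          refine (Finset.abs_sum_le_sum_abs _ _).trans (Finset.sum_le_sum fun k hk => ?_)
          rw [abs_mul, Nat.abs_cast]
          exact mul_le_mul_of_nonneg_left (ih k (by rw [Finset.mem_range] at hk; omega))
            (Nat.cast_nonneg _)
        rw [hD m (by omega), hG m (by omega)]
        refine (abs_add_le _ _).trans (add_le_add (hb _ hn) ?_)
        rw [abs_mul, abs_of_nonneg (by positivity)]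
        exact mul_le_mul_of_nonneg_left htri (by positivity)
  refine (key n).trans ?_
  have : (0 : ℝ) ≤ harmonic n := by
    simpa using harmonic_mono_real (Nat.zero_le n)
  simp only [G]
  nlinarith [mul_nonneg hK this]

theorem avgComparisons_recurrence {T : ∀ n, ClassTree n} (R : Arrangement)
    (hT : ∀ n, (T n).Implements ruleL) {m : ℕ} (hm : 1 ≤ m) :
    avgComparisons T R (m + 1) = m + (m - 1) / 3 +
      mean (m - 1) (fun w => (stepSum costL w : ℝ)) +
        6 / ((m : ℝ) * (m + 1)) * triSum m (avgComparisons T R) := by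
  have hm0 : (m : ℝ) ≠ 0 := by positivity
  rw [avgComparisons_eq_pairMean R hT (by omega : 2 ≤ m + 1), pairMean_fst, pairMean_snd,
    pairMean_rest m (avgComparisons T R), pairMean_rest m fun k => (k : ℝ), triSum_id,
    show m + 1 - 2 = m - 1 by omega]
  push_cast
  field_simp
  ring

/-- The solution of the recurrence with toll `3 / 2 * (n + 1)`. -/
theorem mul_harmonic_recurrence {m : ℕ} (hm : 1 ≤ m) :
    9 / 5 * (((m + 1 : ℕ) + 1 : ℝ) * (harmonic (m + 1 + 1) : ℝ)) = 3 / 2 * (m + 2) +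
      6 / ((m : ℝ) * (m + 1)) *
        triSum m fun k => 9 / 5 * (((k : ℝ) + 1) * (harmonic (k + 1) : ℝ)) := by
  have hm0 : (m : ℝ) ≠ 0 := by positivity
  rw [triSum_const_mul, triSum_mul_harmonic]
  push_cast
  field_simp
  ring

theorem abs_avgComparisons_sub_le {T : ∀ n, ClassTree n} (R : Arrangement)
    (hT : ∀ n, (T n).Implements ruleL) (n : ℕ) :
    |avgComparisons T R n - 9 / 5 * (((n : ℝ) + 1) * (harmonic (n + 1) : ℝ))| ≤
      3 * 8 * (n + 1) := by
  -- The toll differs from `3 / 2 * (n + 1)` by at most `7 / 2 + 3 * H_n ≤ 8 * H_n`.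
  refine abs_le_of_recurrence
    (D := fun n => avgComparisons T R n - 9 / 5 * (((n : ℝ) + 1) * (harmonic (n + 1) : ℝ)))
    (b := fun n => (n - 1) + (n - 2) / 3 + mean (n - 2) (fun w => (stepSum costL w : ℝ)) -
      3 / 2 * (n + 1)) (by norm_num) ?_ ?_ (fun m hm => ?_) (fun n hn => ?_) n
  · rw [avgComparisons_of_le T R zero_le_one]
    norm_num [harmonic, Finset.sum_range_succ, abs_le]
  · rw [avgComparisons_of_le T R le_rfl]
    norm_num [harmonic, Finset.sum_range_succ, abs_le]
  · rw [triSum_sub]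
    have e1 := avgComparisons_recurrence R hT hm
    have e2 := mul_harmonic_recurrence hm
    rw [show m + 1 - 2 = m - 1 by omega]
    rw [e1, e2]
    push_cast
    ring
  · have h1 := abs_mean_costL_sub_le (n - 2)
    have h2 := harmonic_mono_real (Nat.sub_le n 2)
    have h3 := harmonic_mono_real (by omega : 1 ≤ n)
    rw [show (harmonic 1 : ℚ) = 1 by simp [harmonic], Rat.cast_one] at h3
    push_cast [hn] at h1
    rw [abs_le] at h1 ⊢
    constructor <;> linarith

theorem exists_abs_avgComparisons_sub_le :
    ∃ C : ℝ, ∀ (T : ∀ n : ℕ, ClassTree n) (R : Arrangement), (∀ n : ℕ, (T n).Implements ruleL) →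
      ∀ n : ℕ, |avgComparisons T R n - (9 / 5 : ℝ) * n * Real.log n| ≤ C * n := by
  -- `(n + 1) * H_{n + 1}` exceeds `n * log n` by at most `2 * n + 1`.
  refine ⟨60, fun T R hT n => ?_⟩
  rcases Nat.eq_zero_or_pos n with rfl | hn
  · simp [avgComparisons_of_le T R zero_le_one]
  have hn1 : (1 : ℝ) ≤ n := by exact_mod_cast hn
  have h1 := abs_avgComparisons_sub_le R hT n
  have h2 : ((n : ℝ) + 1) * (harmonic (n + 1) : ℝ) = (n + 1) * harmonic n + 1 := by
    rw [cast_harmonic_succ]; field_simp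
  have h3 := harmonic_le_one_add_log n
  have h4 : Real.log n ≤ harmonic n := (Real.log_le_log (by linarith)
    (by push_cast; linarith)).trans (log_add_one_le_harmonic n)
  have h5 := Real.log_le_sub_one_of_pos (by linarith : (0 : ℝ) < n)
  have h6 : 0 ≤ Real.log n := Real.log_nonneg hn1
  rw [h2] at h1
  rw [abs_le] at h1 ⊢
  constructor <;> nlinarith

end DualPivot

theorem mainTheorem3 :
    -- implementability: one tree, not depending on the numbers of small and large elements
    (∀ n : ℕ, ∃ t : DualPivot.ClassTree n, t.Implements DualPivot.ruleL) ∧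
    -- the additional cost terms of `L` and `O` differ by `O(log n)`
    (∃ C : ℝ, ∀ n : ℕ, 2 ≤ n →
      ∀ (tL : DualPivot.ClassTree n) (tO : ℕ → ℕ → DualPivot.ClassTree n),
        tL.Implements DualPivot.ruleL →
        (∀ s l : ℕ, s + l ≤ n - 2 → (tO s l).Implements (DualPivot.ruleO s l)) →
        |DualPivot.ACT n (fun _ _ => tL) - DualPivot.ACT n tO| ≤ C * Real.log n) ∧
    -- sorting with strategy `L`
    (∃ C : ℝ, ∀ (T : ∀ n : ℕ, DualPivot.ClassTree n) (R : DualPivot.Arrangement),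
      (∀ n : ℕ, (T n).Implements DualPivot.ruleL) →
      ∀ n : ℕ, |DualPivot.avgComparisons T R n - (9 / 5 : ℝ) * n * Real.log n| ≤ C * n) :=
  ⟨fun n => DualPivot.exists_implements n DualPivot.ruleL, DualPivot.exists_abs_ACT_sub_le,
    DualPivot.exists_abs_avgComparisons_sub_le⟩
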